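/- Work over $\mathbb{Q}$, with finite-dimensional spaces. Let $\mathsf{Part}$ be the set of integer partitions $\mu=(1^{\mu_1},2^{\mu_2},\dots)$ and $\overline{\mathsf{Part}}$ the set of generalized partitions $\nu=(0^{\nu_0},1^{\nu_1},2^{\nu_2},\dots)$ (finitely many parts, parts of size $0$ allowed). Put $\Lambda=\mathbb{Q}[p_1,p_2,\dots]$ and $\Lambda^{[2]}=\mathbb{Q}[p_i(\mu)\mid i\ge 1,\ \mu\in\mathsf{Part}]$. For $\nu\in\overline{\mathsf{Part}}$ let $\mathbb{S}_\nu=\prod_{i\ge0}S_i\wr S_{\nu_i}$, where $S_m\wr S_n=(S_m)^n\rtimes S_n$. An $\mathbb{S}$-module is a finite-dimensional space $W=\bigoplus_{n\ge0}W_n$ with a representation of $S_n$ on each $W_n$; an $\mathbb{S}^{[2]}$-module is a finite-dimensional space $V=\bigoplus_{\nu\in\overline{\mathsf{Part}}}V_\nu$ with a representation of $\mathbb{S}_\nu$ on each $V_\nu$; morphisms are families of equivariant linear maps. Their Frobenius characteristics are $$\mathrm{ch}_{\mathbb{S}}(W)=\sum_n\frac1{n!}\sum_{\sigma\in S_n}\mathrm{Tr}(\sigma|W_n)\,p_{\sigma}\in\Lambda,\qquad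 \mathrm{ch}_{\mathbb{S}^{[2]}}(V)=\sum_\nu\frac1{|\mathbb{S}_\nu|}\sum_{\tau\in\mathbb{S}_\nu}\mathrm{Tr}(\tau|V_\nu)\,p_{\Theta^\tau}\in\Lambda^{[2]},$$ where $p_\sigma=\prod p_k$ over the cycles of $\sigma$ (of length $k$, fixed points included), and $p_{\Theta^\tau}=\prod p_k(\mu)$ over all $i$ and all cycles of the image of $\tau_i\in S_i\wr S_{\nu_i}$ in $S_{\nu_i}$, with $k$ the length of the cycle and $\mu$ the cycle type of the corresponding cycle product in $S_i$. For $\mu\in\mathsf{Part}$ let $p_\mu^\perp=\big(\prod_i i^{\mu_i}\big)\,\partial^{\mu_1+\mu_2+\cdots}/\partial p_1^{\mu_1}\partial p_2^{\mu_2}\cdots$ on $\Lambda$, and let $\psi_n$ be the algebra endomorphism of $\Lambda$ with $\psi_n(p_k)=p_{nk}$. The action $\circledcirc\colon\Lambda^{[2]}\times\Lambda\to\Lambda$ is the one for which $g\mapsto g\circledcirc f$ is, for each $f\in\Lambda$, the $\mathbb{Q}$-algebra homomorphism with $p_n(\mu)\circledcirc f=\psi_n(p_\mu^\perp f)$. For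 $\mathbb{S}$-modules let $X\boxtimes Y=\bigoplus_n\bigoplus_{k}\mathrm{Ind}_{S_k\times S_{n-k}}^{S_n}X_k\otimes Y_{n-k}$ with its usual symmetry (no signs). For an $\mathbb{S}$-module $W$ let $W(i)_n=\mathrm{Res}^{S_{i+n}}_{S_i\times S_n}W_{i+n}$, an $\mathbb{S}$-module with an action of $S_i$, and for $\nu\in\overline{\mathsf{Part}}$ let $$W^{\otimes\nu}=\mathop{\boxtimes}_{i\ge0}W(i)^{\boxtimes\nu_i},$$ an $\mathbb{S}$-module with an action of $\mathbb{S}_\nu$. For an $\mathbb{S}^{[2]}$-module $V$ let $T_V$ be the endofunctor of the category of $\mathbb{S}$-modules $$T_V(W)=\bigoplus_{\nu\in\overline{\mathsf{Part}}}\mathrm{Hom}_{\mathbb{S}_\nu}\big(V_\nu,W^{\otimes\nu}\big).$$ **Proposition.** For every $\mathbb{S}$-module $W$ and every $\mathbb{S}^{[2]}$-module $V$, $$\mathrm{ch}_{\mathbb{S}}(T_V(W))=\mathrm{ch}_{\mathbb{S}^{[2]}}(V)\circledcirc\mathrm{ch}_{\mathbb{S}}(W).$$ In this sense $T_V$ categorifies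 the action of $\Lambda^{[2]}$ on $\Lambda$. -/

import Mathlib

open scoped DirectSum TensorProduct

universe u

noncomputable section

namespace WreathSymm

/-! ### Partitions and the rings of symmetric functions -/

/-- Integer partitions in multiplicity notation `μ = (1^{μ 1}, 2^{μ 2}, …)`. -/
abbrev Part : Type := ℕ+ →₀ ℕ

/-- Generalized partitions `ν = (0^{ν 0}, 1^{ν 1}, …)`: parts of size `0` are allowed. -/
abbrev GenPart : Type := ℕ →₀ ℕ

/-- `2`-partitions: finitely supported functions from partitions to partitions. -/
abbrev TwoPart : Type := Part →₀ Part

/-- The ring of symmetric functions `Λ = ℚ[p₁, p₂, …]`. -/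
abbrev Lam : Type := MvPolynomial ℕ+ ℚ

/-- The ring of `2`-symmetric functions `Λ^{[2]} = ℚ[p_i(μ) | i ≥ 1, μ a partition]`;
the variable with index `(i, μ)` is `p_i(μ)`. -/
abbrev Lam2 : Type := MvPolynomial (ℕ+ × Part) ℚ

/-- `p_μ = ∏ i, p_i ^ μ_i`. -/
def pPart (μ : Part) : Lam := μ.prod fun i m => MvPolynomial.X i ^ m

/-- `p_Θ = ∏ μ, p_{Θ(μ)}(μ)`, where `p_λ(μ) = ∏ i, p_i(μ) ^ λ_i`. -/
def pTwoPart (Θ : TwoPart) : Lam2 :=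
  Θ.prod fun μ l => l.prod fun i m => MvPolynomial.X (i, μ) ^ m

/-! ### Adams operations, skewing, and the action of `Λ^{[2]}` on `Λ` -/

/-- The Adams operation `ψ_n f = p_n ∘ f`: the algebra endomorphism of `Λ` with
`p_k ↦ p_{nk}`. -/
def psi (n : ℕ+) : Lam →ₐ[ℚ] Lam := MvPolynomial.aeval fun k => MvPolynomial.X (n * k)

/-- The operator `i • ∂/∂p_i` on `Λ`. -/
def skewOne (i : ℕ+) : Module.End ℚ Lam :=
  ((i : ℕ) : ℚ) • ((MvPolynomial.pderiv i : Derivation ℚ Lam Lam) : Lam →ₗ[ℚ] Lam)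

theorem skewOne_commute (i j : ℕ+) : Commute (skewOne i) (skewOne j) := by
  have h : ⁅(MvPolynomial.pderiv i : Derivation ℚ Lam Lam),
      (MvPolynomial.pderiv j : Derivation ℚ Lam Lam)⁆ = 0 := by
    apply MvPolynomial.derivation_ext
    intro k
    rw [Derivation.commutator_apply]
    simp only [MvPolynomial.pderiv_X, Pi.single_apply, Derivation.coe_zero, Pi.zero_apply]
    split_ifs <;> simp
  have h' : Commute ((MvPolynomial.pderiv i : Derivation ℚ Lam Lam) : Module.End ℚ Lam)
      ((MvPolynomial.pderiv j : Derivation ℚ Lam Lam) : Module.End ℚ Lam) := by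
    refine LinearMap.ext fun f => ?_
    have := congrArg (fun D : Derivation ℚ Lam Lam => D f) h
    simp only [Derivation.commutator_apply, Derivation.coe_zero, Pi.zero_apply] at this
    exact sub_eq_zero.mp this
  exact (h'.smul_left _).smul_right _

/-- The skewing operator
`p_μ^⊥ = (∏ i, i ^ μ_i) ∂^{μ_1 + μ_2 + ⋯} / ∂p_1^{μ_1} ∂p_2^{μ_2} ⋯` on `Λ`. -/
def skew (μ : Part) : Module.End ℚ Lam :=
  μ.support.noncommProd (fun i => skewOne i ^ μ i)
    fun i _ j _ _ => (skewOne_commute i j).pow_pow _ _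

/-- The action `g ⊚ f` of `Λ^{[2]}` on `Λ`: for fixed `f` it is the algebra homomorphism in `g`
with `p_n(μ) ⊚ f = ψ_n (p_μ^⊥ f)`. -/
def tcirc (g : Lam2) (f : Lam) : Lam :=
  MvPolynomial.aeval (fun x : ℕ+ × Part => psi x.1 (skew x.2 f)) g

/-! ### `𝕊`-modules -/

/-- An `𝕊`-module over `ℚ`: a finite-dimensional space `⨁ n, V_n` with a representation of the
symmetric group `S_n` on `V_n`. Finite-dimensionality of the total space is expressed by
finite-dimensionality of every `V_n` together with `V_n = 0` for all large `n`. -/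
structure SModule where
  /-- the component `V_n` -/
  V : ℕ → Type u
  [acg : ∀ n, AddCommGroup (V n)]
  [mod : ∀ n, Module ℚ (V n)]
  [fin : ∀ n, Module.Finite ℚ (V n)]
  /-- the action of `S_n` on `V_n` -/
  ρ : ∀ n, Representation ℚ (Equiv.Perm (Fin n)) (V n)
  bounded : ∃ N, ∀ n, N ≤ n → Subsingleton (V n)

attribute [instance] SModule.acg SModule.mod SModule.fin

/-- The cycle type of a permutation (fixed points included) as a partition. -/
def permType {m : ℕ} (σ : Equiv.Perm (Fin m)) : Part :=
  (Multiset.toFinsupp σ.partition.parts).comapDomain (fun k : ℕ+ => (k : ℕ))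
    PNat.coe_injective.injOn

/-- The Frobenius characteristic `ch_n = (1/n!) ∑_{σ ∈ S_n} Tr(σ) p_{type σ}` of a
representation of `S_n`. -/
def chSym {n : ℕ} {X : Type u} [AddCommGroup X] [Module ℚ X]
    (ρ : Representation ℚ (Equiv.Perm (Fin n)) X) : Lam :=
  ((n.factorial : ℚ)⁻¹) • ∑ σ : Equiv.Perm (Fin n), LinearMap.trace ℚ X (ρ σ) • pPart (permType σ)

namespace SModule

/-- The Frobenius characteristic `ch_𝕊(W) = ∑ n, ch_n(W_n)`; only finitely many summands are
nonzero. -/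
def ch (W : SModule.{u}) : Lam := ∑ᶠ n, chSym (W.ρ n)

/-- Morphisms of `𝕊`-modules: sequences of equivariant linear maps. -/
@[ext]
structure Hom (W W' : SModule.{u}) where
  app : ∀ n, (W.ρ n).IntertwiningMap (W'.ρ n)

instance : CategoryTheory.Category SModule.{u} where
  Hom := Hom
  id W := ⟨fun n => Representation.IntertwiningMap.id (W.ρ n)⟩
  comp f g := ⟨fun n => (g.app n).comp (f.app n)⟩

/-- The value of an `𝕊`-module `W` on a finite set `A`, i.e. the extension of `W` from the sets
`{1, …, n}` to all finite sets and bijections: families of vectors of `W_n` indexed by the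
bijections `e : {1, …, n} ≃ A` (so only `n = |A|` contributes), compatible with `S_n`. A choice
of `e` identifies it with `W_{|A|}`. -/
def obj (W : SModule.{u}) (A : Type) : Submodule ℚ (∀ n : ℕ, (Fin n ≃ A) → W.V n) where
  carrier := {φ | ∀ (n : ℕ) (e : Fin n ≃ A) (σ : Equiv.Perm (Fin n)),
    φ n (σ.trans e) = W.ρ n σ⁻¹ (φ n e)}
  add_mem' := by
    intro a b ha hb n e σ
    simp [ha n e σ, hb n e σ]
  zero_mem' := by
    intro n e σ
    simp
  smul_mem' := by
    intro c a ha n e σ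
    simp [ha n e σ]

/-- Transport of `W[A]` along a bijection `A ≃ B`. -/
def objMap (W : SModule.{u}) {A B : Type} (g : A ≃ B) : W.obj A →ₗ[ℚ] W.obj B where
  toFun φ := ⟨fun n e => φ.1 n (e.trans g.symm), fun n e σ => φ.2 n (e.trans g.symm) σ⟩
  map_add' _ _ := rfl
  map_smul' _ _ := rfl

theorem objMap_refl (W : SModule.{u}) {A : Type} (φ : W.obj A) :
    W.objMap (Equiv.refl A) φ = φ := rfl

theorem objMap_trans (W : SModule.{u}) {A B C : Type} (g : A ≃ B) (h : B ≃ C) (φ : W.obj A) :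
    W.objMap (g.trans h) φ = W.objMap h (W.objMap g φ) := rfl

/-- A morphism of `𝕊`-modules induces maps `W[A] → W'[A]`. -/
def Hom.onObj {W W' : SModule.{u}} (f : Hom W W') (A : Type) : W.obj A →ₗ[ℚ] W'.obj A where
  toFun φ := ⟨fun n e => f.app n (φ.1 n e), fun n e σ => by
    change f.app n (φ.1 n (σ.trans e)) = _
    rw [φ.2 n e σ, (f.app n).isIntertwining]⟩
  map_add' _ _ := by
    ext n e
    exact map_add (f.app n) _ _
  map_smul' _ _ := by
    ext n e
    exact map_smul (f.app n) _ _

theorem Hom.onObj_objMap {W W' : SModule.{u}} (f : Hom W W') {A B : Type} (g : A ≃ B)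
    (φ : W.obj A) : f.onObj B (W.objMap g φ) = W'.objMap g (f.onObj A φ) := rfl

/-- Evaluation at a bijection is injective. -/
theorem obj_eval_injective (W : SModule.{u}) {A : Type} {m : ℕ} (e : Fin m ≃ A) :
    Function.Injective (fun φ : W.obj A => φ.1 m e) := by
  intro φ φ' h
  apply Subtype.ext
  funext n e'
  obtain rfl : n = m := by simpa using Fintype.card_congr (e'.trans e.symm)
  have h1 := φ.2 n e (e'.trans e.symm)
  have h2 := φ'.2 n e (e'.trans e.symm)
  have h3 : (e'.trans e.symm).trans e = e' := by ext; simp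
  rw [h3] at h1 h2
  rw [h1, h2]
  exact congrArg _ h

instance obj_finite (W : SModule.{u}) (A : Type) [Finite A] : Module.Finite ℚ (W.obj A) := by
  let e : Fin (Nat.card A) ≃ A := (Finite.equivFin A).symm
  let ev : W.obj A →ₗ[ℚ] W.V (Nat.card A) :=
    { toFun := fun φ => φ.1 _ e
      map_add' := fun _ _ => rfl
      map_smul' := fun _ _ => rfl }
  exact Module.Finite.of_injective ev (W.obj_eval_injective e)

theorem obj_subsingleton (W : SModule.{u}) (A : Type) [Finite A]
    [Subsingleton (W.V (Nat.card A))] : Subsingleton (W.obj A) :=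
  (W.obj_eval_injective (Finite.equivFin A).symm).subsingleton

end SModule

/-! ### The groups `𝕊_ν` and `𝕊^{[2]}`-modules -/

/-- The wreath product `S_m ≀ S_n = (S_m)^n ⋊ S_n`, where `σ ∈ S_n` acts on `(S_m)^n` by
`(σ • f) j = f (σ⁻¹ j)`. -/
abbrev Wreath (m n : ℕ) : Type :=
  (Fin n → Equiv.Perm (Fin m)) ⋊[mulAutArrow (M := Equiv.Perm (Fin m))] Equiv.Perm (Fin n)

instance (m n : ℕ) : Finite (Wreath m n) := Finite.of_equiv _ SemidirectProduct.equivProd.symm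

instance (m n : ℕ) : Fintype (Wreath m n) := Fintype.ofFinite _

/-- The group `𝕊_ν = ∏ i, S_i ≀ S_{ν_i}`; the factors with `ν_i = 0` are trivial and left out. -/
abbrev SGrp (ν : GenPart) : Type := ∀ i : ν.support, Wreath i (ν i)

/-- An `𝕊^{[2]}`-module over `ℚ`: a finite-dimensional space `⨁ ν, V_ν` with a representation of
`𝕊_ν` on `V_ν`. Finite-dimensionality of the total space is expressed by finite-dimensionality of
every `V_ν` together with `V_ν = 0` for all but finitely many `ν`. -/
structure S2Module where
  /-- the component `V_ν` -/
  V : GenPart → Type u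
  [acg : ∀ ν, AddCommGroup (V ν)]
  [mod : ∀ ν, Module ℚ (V ν)]
  [fin : ∀ ν, Module.Finite ℚ (V ν)]
  /-- the action of `𝕊_ν` on `V_ν` -/
  ρ : ∀ ν, Representation ℚ (SGrp ν) (V ν)
  bounded : {ν | Nontrivial (V ν)}.Finite

attribute [instance] S2Module.acg S2Module.mod S2Module.fin

/-- The length of the cycle of `σ` through `x` (equal to `1` for a fixed point). -/
def cycleLen {n : ℕ} (σ : Equiv.Perm (Fin n)) (x : Fin n) : ℕ+ :=
  ⟨Function.minimalPeriod σ x,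
    Function.minimalPeriod_pos_of_mem_periodicPts (σ.injective.mem_periodicPts x)⟩

/-- For `τ = (f; σ) ∈ S_m ≀ S_n` and `x` on a cycle of `σ` of length `k`, the cycle product
`f(x) f(σ⁻¹ x) ⋯ f(σ^{-(k-1)} x) ∈ S_m`; it is the component at `x` of `τ ^ k`. -/
def cycleProd {m n : ℕ} (τ : Wreath m n) (x : Fin n) : Equiv.Perm (Fin m) :=
  (τ ^ (cycleLen τ.right x : ℕ)).left x

instance {n : ℕ} (σ : Equiv.Perm (Fin n)) : Fintype (Quotient (Equiv.Perm.SameCycle.setoid σ)) :=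
  Fintype.ofFinite _

/-- The `2`-partition of `τ ∈ 𝕊_ν`. Writing `τ_i = (f; σ) ∈ S_i ≀ S_{ν_i}`, every cycle of `σ`
(fixed points included) whose cycle product has cycle type `μ` contributes its length as a part
of `Θ(μ)`. The type of the cycle product does not depend on the point chosen on the cycle. -/
def twoType {ν : GenPart} (τ : SGrp ν) : TwoPart :=
  ∑ i : ν.support, ∑ q : Quotient (Equiv.Perm.SameCycle.setoid (τ i).right),
    Finsupp.single (permType (cycleProd (τ i) q.out))
      (Finsupp.single (cycleLen (τ i).right q.out) 1)

/-- The Frobenius characteristic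
`ch_{𝕊_ν} = (1/|𝕊_ν|) ∑_{τ ∈ 𝕊_ν} Tr(τ) p_{Θ^τ}` of a representation of `𝕊_ν`. -/
def chSGrp {ν : GenPart} {X : Type u} [AddCommGroup X] [Module ℚ X]
    (ρ : Representation ℚ (SGrp ν) X) : Lam2 :=
  ((Fintype.card (SGrp ν) : ℚ)⁻¹) •
    ∑ τ : SGrp ν, LinearMap.trace ℚ X (ρ τ) • pTwoPart (twoType τ)

/-- The Frobenius characteristic `ch_{𝕊^{[2]}}(V) = ∑ ν, ch_{𝕊_ν}(V_ν)`; only finitely many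
summands are nonzero. -/
def S2Module.ch (V : S2Module.{u}) : Lam2 := ∑ᶠ ν, chSGrp (V.ρ ν)

/-! ### The `𝕊`-module `W^{⊗ν}` with its action of `𝕊_ν` -/

/-- Indices of the tensor factors of `W^{⊗ν} = ⊠ i, W(i)^{⊠ ν_i}`: pairs `(i, j)` with
`1 ≤ j ≤ ν_i`. -/
abbrev Factor (ν : GenPart) : Type := Σ i : ν.support, Fin (ν i)

/-- The permutation of the tensor factors induced by an element of `𝕊_ν`. -/
def factorPerm {ν : GenPart} (τ : SGrp ν) : Equiv.Perm (Factor ν) :=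
  Equiv.sigmaCongrRight fun i => (τ i).right

section TensorPower

variable (W : SModule.{u}) (ν : GenPart) (n : ℕ)

/-- For a distribution `c` of the labels `1, …, n` over the tensor factors, the space
`⨂_{v = (i, j)} W(i)[c⁻¹ v]`, where `W(i)[B] = W[{1, …, i} ⊔ B]`. -/
abbrev Comp (c : Fin n → Factor ν) : Type u :=
  ⨂[ℚ] v : Factor ν, W.obj (Fin v.1 ⊕ {x // c x = v})

/-- The component `(W^{⊗ν})_n` in degree `n` of the `𝕊`-module `⊠ i, W(i)^{⊠ ν_i}`. The product
`⊠_v X_v` of a finite family of `𝕊`-modules is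
`⨁_{n = ∑ n_v} Ind_{∏ S_{n_v}}^{S_n} ⨂_v (X_v)_{n_v}`; the cosets of `∏ S_{n_v}` in `S_n` are the
maps `c` from the labels to the factors with fibres of sizes `n_v`, which gives
`⨁_c ⨂_v X_v[c⁻¹ v]`. -/
abbrev TensorPow : Type u := ⨁ c : Fin n → Factor ν, Comp W ν n c

variable {ν n}

/-- The distribution `c` moved by `τ ∈ 𝕊_ν` and `g ∈ S_n`. -/
def moveDist (a : SGrp ν × Equiv.Perm (Fin n)) (c : Fin n → Factor ν) : Fin n → Factor ν :=
  fun x => factorPerm a.1 (c (a.2⁻¹ x))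

/-- The bijection by which `(τ, g)` carries the labels of the tensor factor `τ⁻¹ v` to those of
the factor `v = (i, j)`: on `{1, …, i}` it is the `j`-th entry of the `(S_i)^{ν_i}`-part of `τ`,
and on the distributed labels it is `g`. -/
def moveLabels (a : SGrp ν × Equiv.Perm (Fin n)) (c : Fin n → Factor ν) (v : Factor ν) :
    (Fin ((factorPerm a.1).symm v).1 ⊕ {x // c x = (factorPerm a.1).symm v}) ≃
      (Fin v.1 ⊕ {x // moveDist a c x = v}) :=
  Equiv.sumCongr ((a.1 v.1).left v.2)
    (a.2.subtypeEquiv fun x => by simp [moveDist, Equiv.eq_symm_apply])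

/-- The action of `(τ, g)` from the summand of `c` to the summand of the moved distribution. -/
def compAct (a : SGrp ν × Equiv.Perm (Fin n)) (c : Fin n → Factor ν) :
    Comp W ν n c →ₗ[ℚ] Comp W ν n (moveDist a c) :=
  PiTensorProduct.map (fun v => W.objMap (moveLabels a c v)) ∘ₗ
    (PiTensorProduct.reindex ℚ (fun v : Factor ν => W.obj (Fin v.1 ⊕ {x // c x = v}))
      (factorPerm a.1)).toLinearMap

/-- The action of `(τ, g) ∈ 𝕊_ν × S_n` on `(W^{⊗ν})_n`. -/
def tensorAct (a : SGrp ν × Equiv.Perm (Fin n)) : TensorPow W ν n →ₗ[ℚ] TensorPow W ν n :=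
  DirectSum.toModule ℚ _ _ fun c =>
    DirectSum.lof ℚ _ (Comp W ν n) (moveDist a c) ∘ₗ compAct W a c

theorem tensorAct_lof_tprod (a : SGrp ν × Equiv.Perm (Fin n)) (c : Fin n → Factor ν)
    (x : ∀ v : Factor ν, W.obj (Fin v.1 ⊕ {x // c x = v})) :
    tensorAct W a (DirectSum.lof ℚ _ (Comp W ν n) c (PiTensorProduct.tprod ℚ x)) =
      DirectSum.lof ℚ _ (Comp W ν n) (moveDist a c)
        (PiTensorProduct.tprod ℚ fun v =>
          W.objMap (moveLabels a c v) (x ((factorPerm a.1).symm v))) := by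
  simp [tensorAct, compAct, DirectSum.toModule_lof, PiTensorProduct.reindex_tprod,
    PiTensorProduct.map_tprod]

theorem tensorPow_ext {M : Type*} [AddCommMonoid M] [Module ℚ M]
    {f g : TensorPow W ν n →ₗ[ℚ] M}
    (h : ∀ (c : Fin n → Factor ν) (x : ∀ v : Factor ν, W.obj (Fin v.1 ⊕ {x // c x = v})),
      f (DirectSum.lof ℚ _ (Comp W ν n) c (PiTensorProduct.tprod ℚ x)) =
        g (DirectSum.lof ℚ _ (Comp W ν n) c (PiTensorProduct.tprod ℚ x))) : f = g := by
  refine DirectSum.linearMap_ext ℚ fun c => PiTensorProduct.ext ?_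
  ext x
  exact h c x

theorem moveLabels_one (c : Fin n → Factor ν) (v : Factor ν) :
    moveLabels 1 c v = Equiv.refl _ := by
  ext (y | y) <;> rfl

theorem moveLabels_mul (a b : SGrp ν × Equiv.Perm (Fin n)) (c : Fin n → Factor ν)
    (v : Factor ν) : moveLabels (a * b) c v =
      (moveLabels b c ((factorPerm a.1).symm v)).trans (moveLabels a (moveDist b c) v) := by
  ext (y | y) <;> rfl

theorem tensorAct_one : tensorAct W (1 : SGrp ν × Equiv.Perm (Fin n)) = 1 := by
  apply tensorPow_ext
  intro c x
  rw [tensorAct_lof_tprod]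
  have h : (fun v => W.objMap (moveLabels 1 c v) (x v)) = x := funext fun v => by
    rw [moveLabels_one]
    rfl
  exact congrArg (fun y => DirectSum.lof ℚ _ (Comp W ν n) c (PiTensorProduct.tprod ℚ y)) h

theorem tensorAct_mul (a b : SGrp ν × Equiv.Perm (Fin n)) :
    tensorAct W (a * b) = tensorAct W a * tensorAct W b := by
  apply tensorPow_ext
  intro c x
  rw [Module.End.mul_apply, tensorAct_lof_tprod, tensorAct_lof_tprod, tensorAct_lof_tprod]
  refine congrArg (fun y => DirectSum.lof ℚ _ (Comp W ν n) (moveDist (a * b) c)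
    (PiTensorProduct.tprod ℚ y)) (funext fun v => ?_)
  rw [moveLabels_mul]
  rfl

variable (ν n)

/-- `(W^{⊗ν})_n` as a representation of `𝕊_ν × S_n`. -/
def tensorRep : Representation ℚ (SGrp ν × Equiv.Perm (Fin n)) (TensorPow W ν n) where
  toFun a := tensorAct W a
  map_one' := tensorAct_one W
  map_mul' := tensorAct_mul W

/-- `(W^{⊗ν})_n` as a representation of `𝕊_ν`. -/
def tensorRepL : Representation ℚ (SGrp ν) (TensorPow W ν n) :=
  (tensorRep W ν n).comp (MonoidHom.inl _ _)

/-- `(W^{⊗ν})_n` as a representation of `S_n`. -/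
def tensorRepR : Representation ℚ (Equiv.Perm (Fin n)) (TensorPow W ν n) :=
  (tensorRep W ν n).comp (MonoidHom.inr _ _)

theorem tensorRep_comm (τ : SGrp ν) (g : Equiv.Perm (Fin n)) :
    tensorRepL W ν n τ ∘ₗ tensorRepR W ν n g = tensorRepR W ν n g ∘ₗ tensorRepL W ν n τ := by
  change tensorRep W ν n (τ, 1) * tensorRep W ν n (1, g) =
    tensorRep W ν n (1, g) * tensorRep W ν n (τ, 1)
  rw [← map_mul, ← map_mul]
  simp

variable {W} in
/-- The map `(W^{⊗ν})_n → (W'^{⊗ν})_n` induced by a morphism of `𝕊`-modules. -/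
def tensorMap {W' : SModule.{u}} (f : SModule.Hom W W') :
    TensorPow W ν n →ₗ[ℚ] TensorPow W' ν n :=
  DirectSum.lmap fun c =>
    PiTensorProduct.map fun v : Factor ν => f.onObj (Fin v.1 ⊕ {x // c x = v})

variable {W} in
theorem tensorMap_comm {W' : SModule.{u}} (f : SModule.Hom W W')
    (a : SGrp ν × Equiv.Perm (Fin n)) :
    tensorMap ν n f ∘ₗ tensorRep W ν n a = tensorRep W' ν n a ∘ₗ tensorMap ν n f := by
  apply tensorPow_ext
  intro c x
  rw [LinearMap.comp_apply, LinearMap.comp_apply]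
  change tensorMap ν n f (tensorAct W a (DirectSum.lof ℚ _ (Comp W ν n) c
      (PiTensorProduct.tprod ℚ x))) =
    tensorAct W' a (tensorMap ν n f (DirectSum.lof ℚ _ (Comp W ν n) c
      (PiTensorProduct.tprod ℚ x)))
  rw [tensorAct_lof_tprod, tensorMap, DirectSum.lmap_lof, DirectSum.lmap_lof,
    PiTensorProduct.map_tprod, PiTensorProduct.map_tprod, tensorAct_lof_tprod]
  rfl

theorem tensorMap_id : tensorMap ν n (CategoryTheory.CategoryStruct.id W) = LinearMap.id := by
  apply tensorPow_ext
  intro c x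
  rw [tensorMap, DirectSum.lmap_lof, PiTensorProduct.map_tprod]
  rfl

variable {W} in
theorem tensorMap_comp {W' W'' : SModule.{u}} (f : W ⟶ W') (g : W' ⟶ W'') :
    tensorMap ν n (CategoryTheory.CategoryStruct.comp f g) =
      tensorMap ν n g ∘ₗ tensorMap ν n f := by
  apply tensorPow_ext
  intro c x
  rw [LinearMap.comp_apply]
  simp only [tensorMap, DirectSum.lmap_lof, PiTensorProduct.map_tprod]
  rfl

theorem tensorPow_subsingleton (N : ℕ) (hN : ∀ n, N ≤ n → Subsingleton (W.V n))
    (hn : N * Fintype.card (Factor ν) < n) : Subsingleton (TensorPow W ν n) := by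
  have key : ∀ c : Fin n → Factor ν, Subsingleton (Comp W ν n c) := by
    intro c
    obtain ⟨v, hv⟩ := Fintype.exists_lt_card_fiber_of_mul_lt_card (f := c) (n := N)
      (by simpa [mul_comm] using hn)
    have h1 : N ≤ Nat.card (Fin v.1 ⊕ {x // c x = v}) := by
      rw [Nat.card_sum, Nat.card_eq_fintype_card (α := {x // c x = v}), Fintype.card_subtype]
      omega
    have := hN _ h1
    have h2 : Subsingleton (W.obj (Fin v.1 ⊕ {x // c x = v})) := W.obj_subsingleton _
    have h3 : (LinearMap.id : Comp W ν n c →ₗ[ℚ] Comp W ν n c) = 0 := by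
      apply PiTensorProduct.ext
      ext x
      change PiTensorProduct.tprod ℚ x = 0
      exact (PiTensorProduct.tprod ℚ).map_coord_zero v (Subsingleton.elim _ _)
    exact ⟨fun a b => by
      rw [← LinearMap.id_apply (R := ℚ) a, ← LinearMap.id_apply (R := ℚ) b, h3]; simp⟩
  exact ⟨fun a b => DFinsupp.ext fun c => (key c).elim _ _⟩

end TensorPower

/-! ### The endofunctor `T_V` -/

section EndoFunctor

variable (V : S2Module.{u}) (W : SModule.{u})

/-- The space `Hom_{𝕊_ν}(V_ν, (W^{⊗ν})_n)`. -/
abbrev HomComp (n : ℕ) (ν : GenPart) : Type u :=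
  (V.ρ ν).IntertwiningMap (tensorRepL W ν n)

/-- `T_V(W)_n = ⨁ ν, Hom_{𝕊_ν}(V_ν, (W^{⊗ν})_n)`. -/
abbrev TSpace (n : ℕ) : Type u := ⨁ ν : GenPart, HomComp V W n ν

/-- The action of `S_n` on `Hom_{𝕊_ν}(V_ν, (W^{⊗ν})_n)` by composition with the action on
`(W^{⊗ν})_n`. -/
def homRep (n : ℕ) (ν : GenPart) :
    Representation ℚ (Equiv.Perm (Fin n)) (HomComp V W n ν) where
  toFun g :=
    { toFun := fun f => ⟨tensorRepR W ν n g ∘ₗ f.toLinearMap, fun τ => by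
        rw [LinearMap.comp_assoc, f.isIntertwining', ← LinearMap.comp_assoc,
          ← tensorRep_comm, LinearMap.comp_assoc]⟩
      map_add' := fun f f' => by
        apply Representation.IntertwiningMap.ext
        exact LinearMap.comp_add _ _ _
      map_smul' := fun c f => by
        apply Representation.IntertwiningMap.ext
        exact LinearMap.comp_smul _ _ _ }
  map_one' := by
    ext f : 1
    apply Representation.IntertwiningMap.ext
    change tensorRepR W ν n 1 ∘ₗ f.toLinearMap = f.toLinearMap
    rw [map_one]
    rfl
  map_mul' g h := by
    ext f : 1
    apply Representation.IntertwiningMap.ext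
    change tensorRepR W ν n (g * h) ∘ₗ f.toLinearMap =
      tensorRepR W ν n g ∘ₗ (tensorRepR W ν n h ∘ₗ f.toLinearMap)
    rw [map_mul]
    rfl

/-- `T_V(W)_n` as a representation of `S_n`. -/
def TRep (n : ℕ) : Representation ℚ (Equiv.Perm (Fin n)) (TSpace V W n) where
  toFun g := DirectSum.lmap fun ν => homRep V W n ν g
  map_one' := by
    simp only [map_one]
    exact DirectSum.lmap_id
  map_mul' g h := by
    simp only [map_mul]
    exact DirectSum.lmap_comp _ _

theorem homComp_subsingleton (n : ℕ) (ν : GenPart) (h : Subsingleton (V.V ν)) :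
    Subsingleton (HomComp V W n ν) :=
  ⟨fun f g => Representation.IntertwiningMap.ext (LinearMap.ext fun x => by
    rw [Subsingleton.elim x 0, map_zero, map_zero])⟩

theorem homComp_finite (n : ℕ) (ν : GenPart) : Module.Finite ℚ (HomComp V W n ν) := by
  let _ : AddCommGroup (TensorPow W ν n) := Module.addCommMonoidToAddCommGroup ℚ
  let L : HomComp V W n ν →ₗ[ℚ] (V.V ν →ₗ[ℚ] TensorPow W ν n) :=
    { toFun := fun f => f.toLinearMap
      map_add' := fun _ _ => rfl
      map_smul' := fun _ _ => rfl }
  exact Module.Finite.of_injective L fun f g h => Representation.IntertwiningMap.ext h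

theorem TSpace_finite (n : ℕ) : Module.Finite ℚ (TSpace V W n) := by
  have := V.bounded.to_subtype
  let _ := fun ν => (Module.addCommMonoidToAddCommGroup ℚ : AddCommGroup (HomComp V W n ν))
  let _ : AddCommGroup (TSpace V W n) := Module.addCommMonoidToAddCommGroup ℚ
  have := fun ν => homComp_finite V W n ν
  let L : TSpace V W n →ₗ[ℚ] ∀ ν : {ν | Nontrivial (V.V ν)}, HomComp V W n ν :=
    LinearMap.pi fun ν => DirectSum.component ℚ _ _ ν.1
  refine Module.Finite.of_injective L fun f g h => DFinsupp.ext fun ν => ?_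
  rcases subsingleton_or_nontrivial (V.V ν) with hν | hν
  · exact (homComp_subsingleton V W n ν hν).elim _ _
  · exact congrFun h ⟨ν, hν⟩

theorem TSpace_bounded : ∃ N, ∀ n, N ≤ n → Subsingleton (TSpace V W n) := by
  obtain ⟨N, hN⟩ := W.bounded
  obtain ⟨M, hM⟩ := (V.bounded.image fun ν => N * Fintype.card (Factor ν)).bddAbove
  refine ⟨M + 1, fun n hn => ⟨fun f g => DFinsupp.ext fun ν => ?_⟩⟩
  rcases subsingleton_or_nontrivial (V.V ν) with hν | hν
  · exact (homComp_subsingleton V W n ν hν).elim _ _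
  · have h1 : N * Fintype.card (Factor ν) ≤ M := hM ⟨ν, hν, rfl⟩
    have := tensorPow_subsingleton W ν n N hN (by omega)
    exact Representation.IntertwiningMap.ext (LinearMap.ext fun x => Subsingleton.elim _ _)

/-- The `𝕊`-module `T_V(W) = ⨁ ν, Hom_{𝕊_ν}(V_ν, W^{⊗ν})`. -/
def TObj : SModule.{u} where
  V n := TSpace V W n
  acg _ := Module.addCommMonoidToAddCommGroup ℚ
  fin n := TSpace_finite V W n
  ρ n := TRep V W n
  bounded := TSpace_bounded V W

variable {W}

/-- Composition with `W^{⊗ν} → W'^{⊗ν}`. -/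
def homMap {W' : SModule.{u}} (f : SModule.Hom W W') (n : ℕ) (ν : GenPart) :
    HomComp V W n ν →ₗ[ℚ] HomComp V W' n ν where
  toFun φ := ⟨tensorMap ν n f ∘ₗ φ.toLinearMap, fun τ => by
    rw [LinearMap.comp_assoc, φ.isIntertwining', ← LinearMap.comp_assoc]
    change (tensorMap ν n f ∘ₗ tensorRep W ν n (τ, 1)) ∘ₗ _ = _
    rw [tensorMap_comm]
    rfl⟩
  map_add' φ φ' := by
    apply Representation.IntertwiningMap.ext
    exact LinearMap.comp_add _ _ _
  map_smul' c φ := by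
    apply Representation.IntertwiningMap.ext
    exact LinearMap.comp_smul _ _ _

/-- The morphism `T_V(W) → T_V(W')` induced by a morphism `W → W'`. -/
def TMap {W' : SModule.{u}} (f : SModule.Hom W W') : SModule.Hom (TObj V W) (TObj V W') where
  app n :=
    { toLinearMap := DirectSum.lmap fun ν => homMap V f n ν
      isIntertwining' := fun g => by
        change (DirectSum.lmap fun ν => homMap V f n ν) ∘ₗ
            (DirectSum.lmap fun ν => homRep V W n ν g) =
          (DirectSum.lmap fun ν => homRep V W' n ν g) ∘ₗ
            (DirectSum.lmap fun ν => homMap V f n ν)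
        rw [← DirectSum.lmap_comp, ← DirectSum.lmap_comp]
        congr 1
        funext ν
        ext φ : 1
        apply Representation.IntertwiningMap.ext
        change (tensorMap ν n f ∘ₗ tensorRep W ν n (1, g)) ∘ₗ φ.toLinearMap = _
        rw [tensorMap_comm]
        rfl }

/-- The endofunctor `T_V` of the category of `𝕊`-modules,
`T_V(W) = ⨁ ν, Hom_{𝕊_ν}(V_ν, W^{⊗ν})`. -/
def T : CategoryTheory.Functor SModule.{u} SModule.{u} where
  obj W := TObj V W
  map f := TMap V f
  map_id W := by
    refine SModule.Hom.ext (funext fun n => Representation.IntertwiningMap.ext ?_)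
    change (DirectSum.lmap fun ν => homMap V _ n ν) = LinearMap.id
    have h : ∀ ν, homMap V (CategoryTheory.CategoryStruct.id W) n ν = LinearMap.id := fun ν => by
      ext φ : 1
      apply Representation.IntertwiningMap.ext
      change tensorMap ν n _ ∘ₗ φ.toLinearMap = φ.toLinearMap
      rw [tensorMap_id]
      rfl
    simp only [h]
    exact DirectSum.lmap_id
  map_comp {W W' W''} f g := by
    refine SModule.Hom.ext (funext fun n => Representation.IntertwiningMap.ext ?_)
    change (DirectSum.lmap fun ν => homMap V _ n ν) =
      (DirectSum.lmap fun ν => homMap V g n ν) ∘ₗ (DirectSum.lmap fun ν => homMap V f n ν)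
    rw [← DirectSum.lmap_comp]
    congr 1
    funext ν
    ext φ : 1
    apply Representation.IntertwiningMap.ext
    change tensorMap ν n _ ∘ₗ φ.toLinearMap = tensorMap ν n g ∘ₗ (tensorMap ν n f ∘ₗ φ.toLinearMap)
    rw [tensorMap_comp]
    rfl

end EndoFunctor

end WreathSymm

end

noncomputable section

namespace WreathSymm

/-! ### The functionals `ev` -/

/-! The functionals `ev μ : f ↦ z_μ [p_μ] f` separate the elements of Λ, and every `μ` is the cycle
type of some `g ∈ S_n`. At the type of `g`, the characteristic of an 𝕊-module takes the value `Tr g`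
(`SModule.ev_ch`), because a conjugacy class has `n!/z_μ` elements. The claim thus becomes an
identity for the trace of `g` on `T_V(W)_n`.

Averaging over `𝕊_ν` gives the trace on a Hom space as the mean of `Tr(τ⁻¹ | V_ν) · Tr((τ, g) |
W^{⊗ν})` (`trace_intertwiningMap`). Since `τ` and `τ⁻¹` have the same 2-partition (`twoType_inv`)
and ⊚ is linear on the left, everything reduces to `Tr((τ, g) | W^{⊗ν}) = ev (type g) (p_{Θ^τ} ⊚ ch
W)`, which is `trace_tensorAct_eq_ev`.

On the trace side, let `π` be the permutation of the tensor factors. Only distributions `c` with `c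
∘ g = π ∘ c` give diagonal blocks. Each block contributes a product over the cycles `q` of `π` of
traces of return maps (`trace_permTensor`, `trace_tensorAct`). With `k` the length of `q`, the
return map acts by the cycle product on the fixed labels and by `g ^ k` on a fibre of `c`; a cycle
of `g` of length `ℓ` over `q` gives a part `ℓ / k` (`ctype_fiber`).

On the polynomial side, `ev μ` is the constant term after applying `p_μ^⊥`, so one applies `ℓ
∂/∂p_ℓ` for each cycle of `g` to `∏ ψ_k (p_κ^⊥ f)`. Leibniz chooses a `q`; the operator is zero
unless `k ∣ ℓ`, and otherwise passes through `ψ_k` as `(ℓ/k) ∂/∂p_{ℓ/k}` with a factor `k`. That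
factor counts the possible images in `q` of a point on the cycle of `g`, and such choices are
exactly the equivariant maps `c` (`sum_equivariant`, `ev_ctype_adamsProd`). -/

/-- The order `z_μ = ∏ i, i ^ μ_i * μ_i !` of the centralizer of a permutation of type `μ`. -/
def zee (μ : Part) : ℚ := μ.prod fun i m => ((i : ℕ) : ℚ) ^ m * (m.factorial : ℚ)

theorem zee_ne_zero (μ : Part) : zee μ ≠ 0 := by
  refine Finset.prod_ne_zero_iff.2 fun i _ => mul_ne_zero (pow_ne_zero _ ?_) ?_
  · exact_mod_cast i.ne_zero
  · exact_mod_cast Nat.factorial_ne_zero _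

theorem zee_add_single (μ : Part) (i : ℕ+) :
    zee (μ + Finsupp.single i 1) = zee μ * (((i : ℕ) : ℚ) * ((μ i : ℚ) + 1)) := by
  classical
  have h0 : ∀ j : ℕ+, ((j : ℕ) : ℚ) ^ 0 * ((0 : ℕ).factorial : ℚ) = 1 := by simp
  have hs : (μ + Finsupp.single i 1).support ⊆ insert i μ.support := by
    intro j hj
    by_cases hji : j = i
    · simp [hji]
    · simpa [hji, Finsupp.single_apply, Ne.symm hji] using hj
  unfold zee
  rw [Finsupp.prod_of_support_subset _ hs _ fun j _ => h0 j,
    Finsupp.prod_of_support_subset _ (Finset.subset_insert i μ.support) _ fun j _ => h0 j,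
    ← Finset.mul_prod_erase _ _ (Finset.mem_insert_self i _),
    ← Finset.mul_prod_erase _ _ (Finset.mem_insert_self i _)]
  have h1 : ∀ j ∈ (insert i μ.support).erase i,
      ((j : ℕ) : ℚ) ^ ((μ + Finsupp.single i 1 : Part) j) *
        (((μ + Finsupp.single i 1 : Part) j).factorial : ℚ) =
      ((j : ℕ) : ℚ) ^ (μ j) * ((μ j).factorial : ℚ) := by
    intro j hj
    have : i ≠ j := (Finset.ne_of_mem_erase hj).symm
    simp [this]
  rw [Finset.prod_congr rfl h1]
  simp only [Finsupp.add_apply, Finsupp.single_eq_same, Nat.factorial_succ, pow_succ]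
  push_cast
  ring

/-- The functional `f ↦ z_μ [p_μ] f`, the pairing of `f` with `p_μ`. -/
def ev (μ : Part) : Lam →ₗ[ℚ] ℚ := zee μ • MvPolynomial.lcoeff ℚ μ

theorem ev_apply (μ : Part) (f : Lam) : ev μ f = zee μ * MvPolynomial.coeff μ f := rfl

theorem ev_ext {f g : Lam} (h : ∀ μ, ev μ f = ev μ g) : f = g :=
  MvPolynomial.ext _ _ fun μ => mul_left_cancel₀ (zee_ne_zero μ) (h μ)

theorem ev_zero_apply (f : Lam) : ev 0 f = MvPolynomial.constantCoeff f := by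
  simp [ev_apply, zee, MvPolynomial.constantCoeff_eq]

theorem skewOne_apply (i : ℕ+) (f : Lam) :
    skewOne i f = ((i : ℕ) : ℚ) • MvPolynomial.pderiv i f := rfl

/-- Adjointness of `i ∂/∂p_i` and multiplication by `p_i`: differentiation produces `μ_i + 1`, and
`i (μ_i + 1)` is the ratio of the two values of `zee`. -/
theorem ev_skewOne (μ : Part) (i : ℕ+) (f : Lam) :
    ev μ (skewOne i f) = ev (μ + Finsupp.single i 1) f := by
  rw [skewOne_apply, ev_apply, ev_apply, zee_add_single, MvPolynomial.coeff_smul,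
    MvPolynomial.coeff_pderiv, smul_eq_mul]
  ring

theorem ev_skewOne_pow (μ : Part) (i : ℕ+) (m : ℕ) (f : Lam) :
    ev μ ((skewOne i ^ m) f) = ev (μ + Finsupp.single i m) f := by
  induction m generalizing μ with
  | zero => simp
  | succ m ih =>
    rw [pow_succ', Module.End.mul_apply, ev_skewOne, ih, add_assoc, ← Finsupp.single_add,
      add_comm 1 m]

/-- Iterated adjointness. As the `ev μ` separate points, this determines `skew` completely, and its
composition laws follow without reopening the noncommutative product. -/
theorem ev_skew (μ κ : Part) (f : Lam) : ev μ (skew κ f) = ev (μ + κ) f := by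
  classical
  have key : ∀ (s : Finset ℕ+) (comm : (s : Set ℕ+).Pairwise
      (Function.onFun Commute fun i => skewOne i ^ κ i)) (μ : Part),
      ev μ (s.noncommProd (fun i => skewOne i ^ κ i) comm f) =
      ev (μ + ∑ i ∈ s, Finsupp.single i (κ i)) f := by
    intro s
    induction s using Finset.induction_on with
    | empty =>
      intro _ μ
      rw [Finset.noncommProd_empty]
      simp
    | insert i s hi ih =>
      intro comm μ
      rw [Finset.noncommProd_insert_of_notMem _ _ _ _ hi, Module.End.mul_apply, ev_skewOne_pow,
        ih, Finset.sum_insert hi, add_assoc]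
  refine (key κ.support _ μ).trans (congrArg (fun m : Part => ev (μ + m) f) ?_)
  exact κ.sum_single

theorem skew_zero_apply (f : Lam) : skew 0 f = f :=
  ev_ext fun μ => by rw [ev_skew, add_zero]

theorem skewOne_skew (i : ℕ+) (κ : Part) (f : Lam) :
    skewOne i (skew κ f) = skew (κ + Finsupp.single i 1) f :=
  ev_ext fun μ => by
    rw [ev_skewOne, ev_skew, ev_skew, add_assoc, add_comm (Finsupp.single i 1)]

theorem skewOne_mul (i : ℕ+) (f g : Lam) :
    skewOne i (f * g) = skewOne i f * g + f * skewOne i g := by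
  simp only [skewOne_apply, MvPolynomial.pderiv_mul, smul_add, smul_mul_assoc, mul_smul_comm]

theorem skewOne_prod {Q : Type*} [Fintype Q] [DecidableEq Q] (i : ℕ+) (F : Q → Lam) :
    skewOne i (∏ q, F q) = ∑ q, ∏ q', Function.update F q (skewOne i (F q)) q' := by
  have key : ∀ s : Finset Q, skewOne i (∏ q ∈ s, F q) =
      ∑ q ∈ s, ∏ q' ∈ s, Function.update F q (skewOne i (F q)) q' := by
    intro s
    induction s using Finset.induction_on with
    | empty => simp [skewOne_apply]
    | insert a s ha ih =>
      rw [Finset.prod_insert ha, skewOne_mul, ih, Finset.sum_insert ha, Finset.prod_insert ha,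
        Function.update_self, Finset.mul_sum]
      congr 1
      · congr 1
        refine Finset.prod_congr rfl fun q hq => ?_
        rw [Function.update_of_ne (by rintro rfl; exact ha hq)]
      · refine Finset.sum_congr rfl fun q hq => ?_
        rw [Finset.prod_insert ha, Function.update_of_ne (by rintro rfl; exact ha hq)]
  exact key Finset.univ

/-! ### Skewing and Adams operations -/

/-- A partition with one part of size `j`, or the empty partition if `j = 0`. -/
def psing (j : ℕ) : Part := if h : 0 < j then Finsupp.single ⟨j, h⟩ 1 else 0

theorem psing_coe (l : ℕ+) : psing l = Finsupp.single l 1 := by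
  rw [psing, dif_pos l.pos]
  rfl

theorem psi_eq_rename (k : ℕ+) : psi k = MvPolynomial.rename fun j => k * j :=
  MvPolynomial.algHom_ext fun j => by simp [psi]

theorem constantCoeff_psi (k : ℕ+) (f : Lam) :
    MvPolynomial.constantCoeff (psi k f) = MvPolynomial.constantCoeff f := by
  rw [psi_eq_rename, MvPolynomial.constantCoeff_rename]

/-- `ψ_k` is an injective renaming of variables, so `∂/∂p_{kl}` passes through it as `∂/∂p_l`. Of
the coefficient `k * l`, the part `l` is absorbed by `skewOne l`. -/
theorem skewOne_psi_mul (k l : ℕ+) (f : Lam) :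
    skewOne (k * l) (psi k f) = ((k : ℕ) : ℚ) • psi k (skewOne l f) := by
  rw [skewOne_apply, skewOne_apply, psi_eq_rename,
    MvPolynomial.pderiv_rename (f := fun j => k * j) (mul_right_injective k), map_smul, smul_smul]
  push_cast
  rfl

/-- Only variables whose index is a multiple of `k` occur in the image of `ψ_k`. -/
theorem skewOne_psi_of_not_dvd (k l : ℕ+) (h : ¬ k ∣ l) (f : Lam) : skewOne l (psi k f) = 0 := by
  rw [skewOne_apply]
  induction f using MvPolynomial.induction_on with
  | C a => simp
  | add p q hp hq => rw [map_add, map_add, smul_add, hp, hq, add_zero]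
  | mul_X p j hp =>
    have hj : l ≠ k * j := fun e => h ⟨j, e⟩
    have : MvPolynomial.pderiv l (MvPolynomial.X (k * j) : Lam) = 0 :=
      MvPolynomial.pderiv_X_of_ne (Ne.symm hj)
    rw [map_mul, MvPolynomial.pderiv_mul, smul_add, ← smul_mul_assoc, hp]
    simp [psi, this]

/-! ### Products of Adams operations -/

section Wreath

variable {Q : Type*} [Fintype Q] [DecidableEq Q] (k : Q → ℕ+) (f : Q → Lam)

/-- `∏ q, ψ_{k q} (p_{Λ q}^⊥ (f q))`. -/
def adamsProd (Λ : Q → Part) : Lam := ∏ q, psi (k q) (skew (Λ q) (f q))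

/-- Leibniz selects the factor `q` to be differentiated; passing through `ψ_{k q}` adds a part `l /
k q` to its partition. The result is again a combination of products of the same shape, so the
operators can be iterated. -/
theorem skewOne_adamsProd (l : ℕ+) (Λ : Q → Part) :
    skewOne l (adamsProd k f Λ) = ∑ q, if (k q : ℕ) ∣ l then
      ((k q : ℕ) : ℚ) • adamsProd k f (Λ + Pi.single q (psing ((l : ℕ) / k q))) else 0 := by
  rw [adamsProd, skewOne_prod]
  refine Finset.sum_congr rfl fun q _ => ?_
  rw [← Finset.mul_prod_erase _ _ (Finset.mem_univ q), Function.update_self]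
  split_ifs with h
  · obtain ⟨j, rfl⟩ := PNat.dvd_iff.2 h
    have hj : psing (((k q * j : ℕ+) : ℕ) / k q) = Finsupp.single j 1 := by
      rw [PNat.mul_coe, Nat.mul_div_cancel_left _ (k q).pos, psing_coe]
    rw [hj, skewOne_psi_mul, skewOne_skew, adamsProd,
      ← Finset.mul_prod_erase _ _ (Finset.mem_univ q), smul_mul_assoc]
    congr 2
    · simp
    · refine Finset.prod_congr rfl fun q' hq' => ?_
      have := Finset.ne_of_mem_erase hq'
      rw [Function.update_of_ne this]
      simp [this]
  · rw [skewOne_psi_of_not_dvd _ _ (mt PNat.dvd_iff.1 h), zero_mul]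

omit [DecidableEq Q] in
theorem ev_zero_adamsProd (Λ : Q → Part) :
    ev 0 (adamsProd k f Λ) = ∏ q, ev (Λ q) (f q) := by
  rw [ev_zero_apply, adamsProd, map_prod]
  refine Finset.prod_congr rfl fun q _ => ?_
  rw [constantCoeff_psi, ← ev_zero_apply, ev_skew, zero_add]

/-- The linear extension of `adamsProd` to the monoid algebra of families of partitions. -/
def adamsLin : AddMonoidAlgebra ℚ (Q → Part) →ₗ[ℚ] Lam :=
  Finsupp.linearCombination ℚ (adamsProd k f) ∘ₗ
    (AddMonoidAlgebra.coeffLinearEquiv ℚ).toLinearMap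

omit [DecidableEq Q] in
theorem adamsLin_single (Λ : Q → Part) (c : ℚ) :
    adamsLin k f (AddMonoidAlgebra.single Λ c) = c • adamsProd k f Λ := by
  simp [adamsLin]

/-- The multiplier corresponding to `skewOne l`. -/
def skewMul {B : Type*} [DecidableEq B] (qof : B → Q) (t : ℕ+ → Finset B) (l : ℕ+) :
    AddMonoidAlgebra ℚ (Q → Part) :=
  ∑ b ∈ t l, AddMonoidAlgebra.single (Pi.single (qof b) (psing ((l : ℕ) / k (qof b)))) 1

variable {B : Type*} [DecidableEq B] (qof : B → Q) (t : ℕ+ → Finset B)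
  (ht : ∀ l (G : Q → Lam), ∑ b ∈ t l, G (qof b) =
    ∑ q, if (k q : ℕ) ∣ l then ((k q : ℕ) : ℚ) • G q else 0)

-- Differentiation becomes multiplication in a commutative monoid algebra, so that repeated
-- differentiation amounts to expanding a product of sums. The hypothesis `ht` says that over each
-- `q` lie exactly `k q` indices `b ∈ t l` if `k q ∣ l`, and none otherwise: the coefficient `k q`
-- is replaced by a sum over a set.
include ht in
theorem skewOne_adamsLin (l : ℕ+) (P : AddMonoidAlgebra ℚ (Q → Part)) :
    skewOne l (adamsLin k f P) = adamsLin k f (skewMul k qof t l * P) := by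
  induction P using AddMonoidAlgebra.induction_linear with
  | zero => simp
  | add P P' h h' => rw [map_add, map_add, h, h', mul_add, map_add]
  | single Λ c =>
    have h := ht l fun q =>
      adamsProd k f (Λ + (Pi.single q (psing ((l : ℕ) / k q)) : Q → Part))
    rw [adamsLin_single, map_smul, skewOne_adamsProd, ← h, skewMul, Finset.sum_mul, map_sum,
      Finset.smul_sum]
    refine Finset.sum_congr rfl fun b _ => ?_
    rw [AddMonoidAlgebra.single_mul_single, adamsLin_single, one_mul, add_comm]

include ht in
theorem ev_sum_adamsLin {K : Type*} (L : K → ℕ+) (s : Finset K)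
    (P : AddMonoidAlgebra ℚ (Q → Part)) :
    ev (∑ C ∈ s, Finsupp.single (L C) 1) (adamsLin k f P) =
      ev 0 (adamsLin k f ((∏ C ∈ s, skewMul k qof t (L C)) * P)) := by
  classical
  induction s using Finset.induction_on generalizing P with
  | empty => simp
  | insert C s hC ih =>
    rw [Finset.sum_insert hC, add_comm, ← ev_skewOne, skewOne_adamsLin k f qof t ht, ih,
      Finset.prod_insert hC, mul_left_comm, mul_assoc]

-- Expanding the product of multipliers means choosing one index `β C ∈ t (L C)` for every `C`; the
-- constant term of each resulting product is then a product of values of `ev`.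
include ht in
theorem ev_sum_adamsProd {K : Type*} [Fintype K] [DecidableEq K] (L : K → ℕ+) :
    ev (∑ C, Finsupp.single (L C) 1) (∏ q, psi (k q) (f q)) =
      ∑ β ∈ Fintype.piFinset fun C => t (L C), ∏ q,
        ev (∑ C, if qof (β C) = q then psing ((L C : ℕ) / k q) else 0) (f q) := by
  have h0 : ∏ q, psi (k q) (f q) = adamsLin k f 1 := by
    rw [AddMonoidAlgebra.one_def, adamsLin_single, one_smul]
    simp [adamsProd, skew_zero_apply]
  rw [h0, ev_sum_adamsLin k f qof t ht, mul_one]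
  simp only [skewMul]
  rw [Finset.prod_univ_sum, map_sum, map_sum]
  refine Finset.sum_congr rfl fun β _ => ?_
  have h1 : ∏ C, AddMonoidAlgebra.single (R := ℚ)
      (Pi.single (qof (β C)) (psing ((L C : ℕ) / k (qof (β C)))) : Q → Part) 1 =
      AddMonoidAlgebra.single (∑ C, (Pi.single (qof (β C))
        (psing ((L C : ℕ) / k (qof (β C)))) : Q → Part)) 1 := by
    rw [AddMonoidAlgebra.prod_single]
    simp
  rw [h1, adamsLin_single, one_smul, ev_zero_adamsProd]
  refine Finset.prod_congr rfl fun q _ => ?_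
  rw [Finset.sum_apply]
  congr 2
  refine Finset.sum_congr rfl fun C _ => ?_
  rw [Pi.single_apply]
  by_cases h : qof (β C) = q
  · rw [if_pos h.symm, if_pos h, h]
  · rw [if_neg (Ne.symm h), if_neg h]

end Wreath

/-! ### Cycles of permutations -/

section Cycles

open Function

variable {A : Type*} [Finite A]

theorem minimalPeriod_perm_pos (σ : Equiv.Perm A) (x : A) : 0 < minimalPeriod σ x :=
  minimalPeriod_pos_of_mem_periodicPts (σ.injective.mem_periodicPts x)

/-- The length of the cycle of `σ` through `x`. -/
def perLen (σ : Equiv.Perm A) (x : A) : ℕ+ := ⟨minimalPeriod σ x, minimalPeriod_perm_pos σ x⟩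

theorem perLen_coe (σ : Equiv.Perm A) (x : A) : (perLen σ x : ℕ) = minimalPeriod σ x := rfl

omit [Finite A] in
theorem pow_apply_eq_self_iff_dvd (σ : Equiv.Perm A) (n : ℕ) (x : A) :
    (σ ^ n) x = x ↔ minimalPeriod σ x ∣ n := by
  rw [← Equiv.Perm.iterate_eq_pow]
  exact isPeriodicPt_iff_minimalPeriod_dvd

omit [Finite A] in
theorem minimalPeriod_eq_of_iff {A' : Type*} {σ : Equiv.Perm A} {σ' : Equiv.Perm A'} {x : A}
    {x' : A'} (h : ∀ n : ℕ, (σ ^ n) x = x ↔ (σ' ^ n) x' = x') :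
    minimalPeriod σ x = minimalPeriod σ' x' :=
  Nat.dvd_right_iff_eq.1 fun n => by
    rw [← pow_apply_eq_self_iff_dvd, h, pow_apply_eq_self_iff_dvd]

omit [Finite A] in
theorem minimalPeriod_pow_apply (σ : Equiv.Perm A) (i : ℕ) (x : A) :
    minimalPeriod σ ((σ ^ i) x) = minimalPeriod σ x :=
  minimalPeriod_eq_of_iff fun n => by
    rw [← Equiv.Perm.mul_apply, ← pow_add, add_comm, pow_add, Equiv.Perm.mul_apply,
      (σ ^ i).injective.eq_iff]

omit [Finite A] in
/-- The points `out q` represent the cycles of `σ`, each cycle once. -/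
def IsTransversal {Q : Type*} (σ : Equiv.Perm A) (out : Q → A) : Prop :=
  Bijective fun p : Σ q, Fin (minimalPeriod σ (out q)) => (σ ^ (p.2 : ℕ)) (out p.1)

theorem isTransversal_out (σ : Equiv.Perm A) :
    IsTransversal σ (Quotient.out : Quotient (Equiv.Perm.SameCycle.setoid σ) → A) := by
  have hmk : ∀ p : Σ q : Quotient (Equiv.Perm.SameCycle.setoid σ),
      Fin (minimalPeriod σ q.out), (⟦(σ ^ (p.2 : ℕ)) p.1.out⟧ :
        Quotient (Equiv.Perm.SameCycle.setoid σ)) = p.1 := by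
    intro p
    refine Eq.trans (Quotient.sound ?_) p.1.out_eq
    exact Equiv.Perm.sameCycle_pow_left.2 (Equiv.Perm.SameCycle.refl _ _)
  constructor
  · rintro ⟨q, i⟩ ⟨q', i'⟩ h
    obtain rfl : q = q' := by
      exact (hmk ⟨q, i⟩).symm.trans ((congrArg (Quotient.mk _) h).trans (hmk ⟨q', i'⟩))
    have h' : (σ ^ (i : ℕ)) q.out = (σ ^ (i' : ℕ)) q.out := h
    rw [← Equiv.Perm.iterate_eq_pow, ← Equiv.Perm.iterate_eq_pow,
      iterate_eq_iterate_iff_of_lt_minimalPeriod i.2 i'.2] at h'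
    rw [Fin.ext h']
  · intro x
    have h : σ.SameCycle (⟦x⟧ : Quotient (Equiv.Perm.SameCycle.setoid σ)).out x :=
      Quotient.exact (Quotient.out_eq (⟦x⟧ : Quotient (Equiv.Perm.SameCycle.setoid σ)))
    obtain ⟨n, hn⟩ := h.exists_nat_pow_eq
    refine ⟨⟨⟦x⟧, ⟨n % _, Nat.mod_lt _ (minimalPeriod_perm_pos σ _)⟩⟩, ?_⟩
    change (σ ^ (n % _)) _ = x
    rw [← Equiv.Perm.iterate_eq_pow, iterate_mod_minimalPeriod_eq, Equiv.Perm.iterate_eq_pow, hn]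

namespace IsTransversal

variable {Q : Type*} {σ : Equiv.Perm A} {out : Q → A} (hT : IsTransversal σ out)

/-- Points of `A` as points of the cycles. -/
def equiv : (Σ q, Fin (minimalPeriod σ (out q))) ≃ A := Equiv.ofBijective _ hT

omit [Finite A] in
theorem equiv_apply (p) : hT.equiv p = (σ ^ (p.2 : ℕ)) (out p.1) := rfl

/-- The cycle containing a point. -/
def cyc (x : A) : Q := (hT.equiv.symm x).1

omit [Finite A] in
theorem exists_pow (x : A) : ∃ i : ℕ, i < minimalPeriod σ (out (hT.cyc x)) ∧
    (σ ^ i) (out (hT.cyc x)) = x :=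
  ⟨(hT.equiv.symm x).2, (hT.equiv.symm x).2.2, hT.equiv.apply_symm_apply x⟩

omit [Finite A] in
theorem minimalPeriod_out_cyc (x : A) :
    minimalPeriod σ (out (hT.cyc x)) = minimalPeriod σ x := by
  obtain ⟨i, _, hi⟩ := hT.exists_pow x
  conv_rhs => rw [← hi, minimalPeriod_pow_apply]

theorem cyc_pow_out (i : ℕ) (q : Q) : hT.cyc ((σ ^ i) (out q)) = q := by
  have h : hT.equiv ⟨q, ⟨i % _, Nat.mod_lt _ (minimalPeriod_perm_pos σ (out q))⟩⟩ =
      (σ ^ i) (out q) := by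
    rw [equiv_apply, ← Equiv.Perm.iterate_eq_pow, ← Equiv.Perm.iterate_eq_pow]
    exact iterate_mod_minimalPeriod_eq
  rw [cyc, ← h, Equiv.symm_apply_apply]

theorem cyc_pow (i : ℕ) (x : A) : hT.cyc ((σ ^ i) x) = hT.cyc x := by
  obtain ⟨j, _, hj⟩ := hT.exists_pow x
  conv_lhs => rw [← hj, ← Equiv.Perm.mul_apply, ← pow_add, cyc_pow_out]

theorem cyc_apply (x : A) : hT.cyc (σ x) = hT.cyc x := hT.cyc_pow 1 x

theorem cyc_out (q : Q) : hT.cyc (out q) = q := hT.cyc_pow_out 0 q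

omit [Finite A] in
include hT in
theorem sum_eq [Fintype A] [Fintype Q] {M : Type*} [AddCommMonoid M] (F : A → M) :
    ∑ x, F x = ∑ q, ∑ i : Fin (minimalPeriod σ (out q)), F ((σ ^ (i : ℕ)) (out q)) := by
  rw [← hT.equiv.sum_comp, Fintype.sum_sigma]
  rfl

omit [Finite A] in
include hT in
theorem sum_eq_of_const [Fintype A] [Fintype Q] {M : Type*} [AddCommMonoid M] (F : A → M)
    (hF : ∀ x, F (σ x) = F x) : ∑ x, F x = ∑ q, minimalPeriod σ (out q) • F (out q) := by
  have h : ∀ (i : ℕ) x, F ((σ ^ i) x) = F x := by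
    intro i x
    induction i with
    | zero => rfl
    | succ i ih => rw [pow_succ', Equiv.Perm.mul_apply, hF, ih]
  rw [hT.sum_eq]
  simp [h]

/-- A power `σ ^ l` fixes all points of a cycle whose length divides `l` and no point of any other
cycle. This supplies the hypothesis `ht` above, with `t l` the fixed points of `σ ^ l`. -/
theorem sum_filter_pow [Fintype A] [DecidableEq A] [Fintype Q] {M : Type*} [AddCommMonoid M]
    (l : ℕ) (G : Q → M) : ∑ x with (σ ^ l) x = x, G (hT.cyc x) =
      ∑ q, if minimalPeriod σ (out q) ∣ l then minimalPeriod σ (out q) • G q else 0 := by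
  rw [Finset.sum_filter, hT.sum_eq_of_const]
  · refine Finset.sum_congr rfl fun q _ => ?_
    simp only [pow_apply_eq_self_iff_dvd, cyc_out]
    split_ifs <;> simp
  · intro x
    have : minimalPeriod σ (σ x) = minimalPeriod σ x := minimalPeriod_pow_apply σ 1 x
    simp only [pow_apply_eq_self_iff_dvd, cyc_apply, this]

end IsTransversal

/-- Lets the cycles of the separate components of `τ ∈ 𝕊_ν` be treated as the cycles of one
permutation of all tensor factors. -/
theorem isTransversal_sigma {I : Type*} {X : I → Type*} {Q : I → Type*}
    (σ : ∀ i, Equiv.Perm (X i)) (out : ∀ i, Q i → X i) (h : ∀ i, IsTransversal (σ i) (out i)) :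
    IsTransversal (Equiv.sigmaCongrRight σ)
      (fun q : Σ i, Q i => (⟨q.1, out q.1 q.2⟩ : Σ i, X i)) := by
  have hpow : ∀ (n : ℕ) (i : I) (x : X i),
      (Equiv.sigmaCongrRight σ ^ n) ⟨i, x⟩ = ⟨i, (σ i ^ n) x⟩ := by
    intro n i x
    induction n with
    | zero => rfl
    | succ n ih => rw [pow_succ', Equiv.Perm.mul_apply, ih, pow_succ']; rfl
  have hper : ∀ (i : I) (x : X i), minimalPeriod (Equiv.sigmaCongrRight σ) (⟨i, x⟩ : Σ i, X i) =
      minimalPeriod (σ i) x := by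
    intro i x
    refine minimalPeriod_eq_of_iff fun n => ?_
    rw [hpow]
    simp
  constructor
  · rintro ⟨⟨i, q⟩, j⟩ ⟨⟨i', q'⟩, j'⟩ e
    simp only [hpow] at e
    obtain ⟨rfl, e⟩ := Sigma.mk.inj_iff.1 e
    have := @(h i).1 ⟨q, j.cast (hper _ _)⟩ ⟨q', j'.cast (hper _ _)⟩ (eq_of_heq e)
    obtain ⟨rfl, e'⟩ := Sigma.mk.inj_iff.1 this
    have e'' := congrArg Fin.val (eq_of_heq e')
    simp only [Fin.val_cast] at e''
    rw [Fin.ext e'']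
  · rintro ⟨i, x⟩
    obtain ⟨⟨q, j⟩, hj⟩ := (h i).2 x
    refine ⟨⟨⟨i, q⟩, j.cast (hper _ _).symm⟩, ?_⟩
    simp only [hpow, Fin.val_cast]
    exact congrArg _ hj

end Cycles

/-! ### Cycle types -/

section CycleType

open Function

variable {A : Type*} [Fintype A] [DecidableEq A]

/-- The cycle type of a permutation of a finite set, fixed points included. -/
def ctype (σ : Equiv.Perm A) : Part :=
  (Multiset.toFinsupp σ.partition.parts).comapDomain (fun k : ℕ+ => (k : ℕ))
    PNat.coe_injective.injOn

theorem permType_eq_ctype {m : ℕ} (σ : Equiv.Perm (Fin m)) : permType σ = ctype σ := rfl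

theorem ctype_apply (σ : Equiv.Perm A) (k : ℕ+) :
    ctype σ k = σ.partition.parts.count (k : ℕ) := rfl

theorem minimalPeriod_eq_card_support_cycleOf (σ : Equiv.Perm A) (x : A) (hx : σ x ≠ x) :
    minimalPeriod σ x = (σ.cycleOf x).support.card := by
  have hc := σ.isCycle_cycleOf hx
  rw [← hc.orderOf]
  refine Nat.dvd_right_iff_eq.1 fun n => ?_
  rw [← pow_apply_eq_self_iff_dvd, orderOf_dvd_iff_pow_eq_one, hc.pow_eq_one_iff,
    ← σ.cycleOf_pow_apply_self]
  constructor
  · intro h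
    exact ⟨x, by simpa using hx, h⟩
  · rintro ⟨y, hy, h⟩
    rw [hc.pow_eq_one_iff.2 ⟨y, hy, h⟩, Equiv.Perm.one_apply]

/-- Both sides count the points on cycles of length `k`. Through `part_ext_of_mul`, cycle types can
be compared by counting points of given minimal period. -/
theorem mul_ctype (σ : Equiv.Perm A) (k : ℕ+) :
    (k : ℕ) * ctype σ k = Fintype.card {x // minimalPeriod σ x = k} := by
  rw [ctype_apply, Equiv.Perm.parts_partition, Multiset.count_add, Fintype.card_subtype]
  -- `cycleType` omits fixed points; they enter `partition` as a separate block of ones.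
  by_cases hk : k = 1
  · subst hk
    have h1 : σ.cycleType.count 1 = 0 :=
      Multiset.count_eq_zero.2 fun h => lt_irrefl _ (Equiv.Perm.one_lt_of_mem_cycleType h)
    rw [PNat.one_coe, h1, zero_add, one_mul, Multiset.count_replicate_self,
      ← Finset.card_compl]
    congr 1
    ext x
    simp [minimalPeriod_eq_one_iff_isFixedPt, IsFixedPt]
  · have hk' : (k : ℕ) ≠ 1 := fun h => hk (PNat.coe_eq_one_iff.1 h)
    rw [Multiset.count_replicate, if_neg (Ne.symm hk'), add_zero, Equiv.Perm.CycleType.count_def]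
    have h2 : (Finset.univ.filter fun x => minimalPeriod σ x = k) =
        (σ.cycleFactorsFinset.filter fun c => c.support.card = (k : ℕ)).biUnion fun c => c.support := by
      ext x
      simp only [Finset.mem_filter, Finset.mem_univ, true_and, Finset.mem_biUnion]
      constructor
      · intro h
        have hx : σ x ≠ x := fun e => hk' (by
          rw [← h]; exact minimalPeriod_eq_one_iff_isFixedPt.2 e)
        refine ⟨σ.cycleOf x, ⟨Equiv.Perm.cycleOf_mem_cycleFactorsFinset_iff.2
          (Equiv.Perm.mem_support.2 hx), ?_⟩, ?_⟩
        · rw [← minimalPeriod_eq_card_support_cycleOf σ x hx, h]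
        · simpa using hx
      · rintro ⟨c, ⟨hc, hck⟩, hx⟩
        have e := Equiv.Perm.cycle_is_cycleOf hx hc
        have hx' : σ x ≠ x := Equiv.Perm.mem_support.1
          (Equiv.Perm.mem_cycleFactorsFinset_support_le hc hx)
        rw [minimalPeriod_eq_card_support_cycleOf σ x hx', ← e, hck]
    rw [h2, Finset.card_biUnion, Finset.sum_congr rfl fun c hc => (Finset.mem_filter.1 hc).2,
      Finset.sum_const, smul_eq_mul, mul_comm]
    · congr 1
      rw [Fintype.card_subtype, Finset.univ_eq_attach,
        Finset.filter_attach (fun c : Equiv.Perm A => c.support.card = (k : ℕ))]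
      simp
    · intro c hc d hd hcd
      exact (σ.cycleFactorsFinset_pairwise_disjoint (Finset.mem_filter.1 hc).1
        (Finset.mem_filter.1 hd).1 hcd).disjoint_support

theorem part_ext_of_mul {μ κ : Part} (h : ∀ k : ℕ+, (k : ℕ) * μ k = k * κ k) : μ = κ :=
  Finsupp.ext fun k => Nat.eq_of_mul_eq_mul_left k.pos (h k)

theorem ctype_eq_of_equiv {A' : Type*} [Fintype A'] [DecidableEq A'] {σ : Equiv.Perm A}
    {σ' : Equiv.Perm A'} (e : A ≃ A') (h : ∀ x, e (σ x) = σ' (e x)) : ctype σ = ctype σ' := by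
  refine part_ext_of_mul fun k => ?_
  rw [mul_ctype, mul_ctype]
  refine Fintype.card_congr (e.subtypeEquiv fun x => ?_)
  have hp : ∀ n : ℕ, e ((σ ^ n) x) = (σ' ^ n) (e x) := by
    intro n
    induction n with
    | zero => rfl
    | succ n ih => rw [pow_succ', pow_succ', Equiv.Perm.mul_apply, Equiv.Perm.mul_apply, h, ih]
  rw [minimalPeriod_eq_of_iff (σ' := σ') (x' := e x) fun n => by rw [← hp, e.injective.eq_iff]]

theorem ctype_inv (σ : Equiv.Perm A) : ctype σ⁻¹ = ctype σ := by
  refine part_ext_of_mul fun k => ?_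
  rw [mul_ctype, mul_ctype]
  refine Fintype.card_congr (Equiv.subtypeEquivRight fun x => ?_)
  rw [minimalPeriod_eq_of_iff (σ' := σ) (x' := x) fun n => by
    rw [inv_pow, Equiv.Perm.inv_eq_iff_eq, eq_comm]]

theorem ctype_sumCongr {A' : Type*} [Fintype A'] [DecidableEq A'] (σ : Equiv.Perm A)
    (σ' : Equiv.Perm A') : ctype (Equiv.sumCongr σ σ') = ctype σ + ctype σ' := by
  have hp : ∀ (n : ℕ) y, (Equiv.sumCongr σ σ' ^ n : Equiv.Perm (A ⊕ A')) y =
      Equiv.sumCongr (σ ^ n) (σ' ^ n) y := by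
    intro n y
    induction n with
    | zero => rcases y with y | y <;> rfl
    | succ n ih =>
      rw [pow_succ', Equiv.Perm.mul_apply, ih]
      rcases y with y | y <;> simp [pow_succ']
  refine part_ext_of_mul fun k => ?_
  rw [Finsupp.add_apply, mul_add, mul_ctype, mul_ctype, mul_ctype, ← Fintype.card_sum]
  refine Fintype.card_congr (Equiv.subtypeSum.trans (Equiv.sumCongr
    (Equiv.subtypeEquivRight fun x => ?_) (Equiv.subtypeEquivRight fun x => ?_)))
  · rw [minimalPeriod_eq_of_iff (σ' := σ) (x' := x) fun n => by rw [hp]; simp]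
  · rw [minimalPeriod_eq_of_iff (σ' := σ') (x' := x) fun n => by rw [hp]; simp]

theorem IsTransversal.ctype_eq {Q : Type*} [Fintype Q] {σ : Equiv.Perm A} {out : Q → A}
    (hT : IsTransversal σ out) : ctype σ = ∑ q, Finsupp.single (perLen σ (out q)) 1 := by
  refine part_ext_of_mul fun k => ?_
  rw [mul_ctype, Fintype.card_subtype, Finset.card_filter, hT.sum_eq_of_const, Finsupp.finsetSum_apply,
    Finset.mul_sum]
  · refine Finset.sum_congr rfl fun q _ => ?_
    rw [Finsupp.single_apply]
    by_cases h : minimalPeriod σ (out q) = k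
    · rw [if_pos h, if_pos (PNat.eq ((perLen_coe σ (out q)).trans h)), h, smul_eq_mul]
    · rw [if_neg h, if_neg fun e => h ((perLen_coe σ (out q)).symm.trans (congrArg PNat.val e))]
      simp
  · intro x
    have : minimalPeriod σ (σ x) = minimalPeriod σ x := minimalPeriod_pow_apply σ 1 x
    rw [this]

theorem card_eq_of_ctype_eq {A' : Type*} [Fintype A'] [DecidableEq A'] {σ : Equiv.Perm A}
    {σ' : Equiv.Perm A'} (h : ctype σ = ctype σ') : Fintype.card A = Fintype.card A' := by
  have key : ∀ k : ℕ, Fintype.card {x // minimalPeriod σ x = k} =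
      Fintype.card {x // minimalPeriod σ' x = k} := by
    intro k
    rcases Nat.eq_zero_or_pos k with rfl | hk
    · rw [Fintype.card_eq_zero_iff.2, Fintype.card_eq_zero_iff.2]
      · exact ⟨fun x => (minimalPeriod_perm_pos σ' x.1).ne' x.2⟩
      · exact ⟨fun x => (minimalPeriod_perm_pos σ x.1).ne' x.2⟩
    · obtain ⟨k, rfl⟩ : ∃ k' : ℕ+, (k' : ℕ) = k := ⟨⟨k, hk⟩, rfl⟩
      rw [← mul_ctype, ← mul_ctype, h]
  exact Fintype.card_congr ((Equiv.sigmaFiberEquiv (minimalPeriod σ)).symm.trans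
    ((Equiv.sigmaCongrRight fun k => Fintype.equivOfCardEq (key k)).trans
      (Equiv.sigmaFiberEquiv (minimalPeriod σ'))))

theorem exists_permType_eq (μ : Part) :
    ∃ (n : ℕ) (g : Equiv.Perm (Fin n)), permType g = μ := by
  classical
  set M : Multiset ℕ := Finsupp.toMultiset (μ.mapDomain PNat.val) with hM
  have hcount : ∀ k : ℕ+, M.count (k : ℕ) = μ k := fun k => by
    rw [hM, Finsupp.count_toMultiset]
    exact Finsupp.mapDomain_apply PNat.coe_injective μ k
  have hpos : ∀ a ∈ M, 0 < a := by
    intro a ha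
    rw [hM, Finsupp.mem_toMultiset] at ha
    obtain ⟨k, _, rfl⟩ := Finset.mem_image.1 (Finsupp.mapDomain_support ha)
    exact k.pos
  have hsplit : M.sum = (M.filter (2 ≤ ·)).sum + M.count 1 := by
    conv_lhs => rw [← Multiset.filter_add_not (2 ≤ ·) M, Multiset.sum_add]
    congr 1
    have : M.filter (fun a => ¬ 2 ≤ a) = Multiset.replicate (M.count 1) 1 := by
      rw [← Multiset.filter_eq]
      refine Multiset.filter_congr fun a ha => ?_
      have := hpos a ha
      omega
    rw [this, Multiset.sum_replicate, smul_eq_mul, mul_one]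
  -- Only the parts of size at least 2 are prescribed as cycles; by `hsplit` the remaining points,
  -- which become fixed points, are as many as the parts equal to 1.
  obtain ⟨g, hg⟩ := (Equiv.Perm.exists_with_cycleType_iff (α := Fin M.sum)
    (m := M.filter (2 ≤ ·))).2 ⟨by rw [Fintype.card_fin]; omega,
      fun a ha => (Multiset.mem_filter.1 ha).2⟩
  refine ⟨M.sum, g, Finsupp.ext fun k => ?_⟩
  rw [permType_eq_ctype, ctype_apply, Equiv.Perm.parts_partition, ← Equiv.Perm.sum_cycleType, hg,
    Fintype.card_fin, Multiset.count_add, Multiset.count_replicate, ← hcount]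
  by_cases hk : (k : ℕ) = 1
  · rw [hk, if_pos rfl, Multiset.count_filter_of_neg (by omega)]
    omega
  · have := k.pos
    rw [if_neg (Ne.symm hk), add_zero, Multiset.count_filter_of_pos (by omega)]

end CycleType

/-! ### Values of Frobenius characteristics -/

section Char

variable {A : Type*} [Fintype A] [DecidableEq A]

theorem ctype_eq_iff_isConj {σ σ' : Equiv.Perm A} : ctype σ = ctype σ' ↔ IsConj σ σ' := by
  rw [Equiv.Perm.partition_eq_of_isConj]
  refine ⟨fun h => ?_, fun h => Finsupp.ext fun k => by
    rw [ctype_apply, ctype_apply, h]⟩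
  refine Nat.Partition.ext (Multiset.ext.2 fun k => ?_)
  -- `ctype` records multiplicities of positive sizes only; size zero never occurs as a part.
  rcases Nat.eq_zero_or_pos k with rfl | hk
  · rw [Multiset.count_eq_zero.2 fun h0 => lt_irrefl _ (σ.partition.parts_pos h0),
      Multiset.count_eq_zero.2 fun h0 => lt_irrefl _ (σ'.partition.parts_pos h0)]
  · obtain ⟨k, rfl⟩ : ∃ k' : ℕ+, (k' : ℕ) = k := ⟨⟨k, hk⟩, rfl⟩
    rw [← ctype_apply, ← ctype_apply, h]

/-- Brings `zee` to the form of the centralizer order in `Equiv.Perm.card_isConj_mul_eq`, where the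
fixed points contribute the separate factorial. -/
theorem zee_ctype (σ : Equiv.Perm A) : zee (ctype σ) =
    (((Fintype.card A - σ.cycleType.sum).factorial * σ.cycleType.prod *
      ∏ n ∈ σ.cycleType.toFinset, (σ.cycleType.count n).factorial : ℕ) : ℚ) := by
  have hone : 1 ∉ σ.cycleType.toFinset := fun h =>
    lt_irrefl _ (Equiv.Perm.one_lt_of_mem_cycleType (Multiset.mem_toFinset.1 h))
  have h1 : zee (ctype σ) = ∏ j ∈ insert 1 σ.cycleType.toFinset,
      ((j : ℚ) ^ (σ.partition.parts.count j) * ((σ.partition.parts.count j).factorial : ℚ)) := by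
    unfold zee Finsupp.prod
    refine (Finset.prod_map _ ⟨PNat.val, PNat.coe_injective⟩ fun j : ℕ =>
      ((j : ℚ) ^ (σ.partition.parts.count j) *
        ((σ.partition.parts.count j).factorial : ℚ))).symm.trans ?_
    refine Finset.prod_subset (fun j hj => ?_) fun j hj hj' => ?_
    · obtain ⟨k, hk, rfl⟩ := Finset.mem_map.1 hj
      rw [Finsupp.mem_support_iff, ctype_apply, ← Nat.pos_iff_ne_zero, Multiset.count_pos,
        Equiv.Perm.parts_partition, Multiset.mem_add] at hk
      rcases hk with hk | hk
      · exact Finset.mem_insert_of_mem (Multiset.mem_toFinset.2 hk)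
      · exact Finset.mem_insert.2 (Or.inl (Multiset.eq_of_mem_replicate hk))
    · have hpos : 0 < j := by
        rcases Finset.mem_insert.1 hj with rfl | hj
        · exact one_pos
        · exact (Equiv.Perm.one_lt_of_mem_cycleType (Multiset.mem_toFinset.1 hj)).trans' one_pos
      obtain ⟨k, rfl⟩ : ∃ k' : ℕ+, (k' : ℕ) = j := ⟨⟨j, hpos⟩, rfl⟩
      have : σ.partition.parts.count (k : ℕ) = 0 := by
        by_contra h0
        exact hj' (Finset.mem_map.2 ⟨k, Finsupp.mem_support_iff.2 h0, rfl⟩)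
      simp [this]
  rw [h1, Finset.prod_insert hone]
  have h2 : σ.partition.parts.count 1 = Fintype.card A - σ.cycleType.sum := by
    rw [Equiv.Perm.parts_partition, Multiset.count_add, Multiset.count_replicate_self,
      Multiset.count_eq_zero.2 fun h => hone (Multiset.mem_toFinset.2 h), zero_add,
      Equiv.Perm.sum_cycleType]
  have h3 : ∀ j ∈ σ.cycleType.toFinset, ((j : ℚ) ^ (σ.partition.parts.count j) *
      ((σ.partition.parts.count j).factorial : ℚ)) =
      (j : ℚ) ^ (σ.cycleType.count j) * ((σ.cycleType.count j).factorial : ℚ) := by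
    intro j hj
    have hj1 : 1 ≠ j := by rintro rfl; exact hone hj
    rw [Equiv.Perm.parts_partition, Multiset.count_add, Multiset.count_replicate, if_neg hj1,
      add_zero]
  rw [Finset.prod_congr rfl h3, h2, Finset.prod_mul_distrib, Finset.prod_multiset_count]
  push_cast
  ring

theorem card_ctype_mul_zee (σ : Equiv.Perm A) :
    ((Finset.univ.filter fun σ' : Equiv.Perm A => ctype σ' = ctype σ).card : ℚ) * zee (ctype σ) =
      ((Fintype.card A).factorial : ℚ) := by
  have h : (Finset.univ.filter fun σ' : Equiv.Perm A => ctype σ' = ctype σ).card =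
      Nat.card {σ' : Equiv.Perm A | IsConj σ σ'} := by
    rw [Nat.card_eq_card_toFinset]
    congr 1
    ext σ'
    rw [Finset.mem_filter, Set.mem_toFinset, ctype_eq_iff_isConj, isConj_comm]
    exact and_iff_right (Finset.mem_univ _)
  rw [zee_ctype, h, ← Nat.cast_mul, Equiv.Perm.card_isConj_mul_eq]

end Char

theorem pPart_eq_monomial (μ : Part) : pPart μ = MvPolynomial.monomial μ 1 := by
  rw [MvPolynomial.monomial_eq, map_one, one_mul]
  rfl

section

variable {n : ℕ} {X : Type u} [AddCommGroup X] [Module ℚ X]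
  (ρ : Representation ℚ (Equiv.Perm (Fin n)) X)

theorem ev_chSym (μ : Part) : ev μ (chSym ρ) = ((n.factorial : ℚ)⁻¹) *
    ∑ σ : Equiv.Perm (Fin n), if permType σ = μ then zee μ * LinearMap.trace ℚ X (ρ σ) else 0 := by
  rw [chSym, map_smul, map_sum, smul_eq_mul]
  congr 1
  refine Finset.sum_congr rfl fun σ _ => ?_
  rw [map_smul, pPart_eq_monomial, ev_apply, MvPolynomial.coeff_monomial, smul_eq_mul]
  split_ifs <;> ring

/-- The trace is a class function, and the size of the class times `z_μ` cancels the denominator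
`n!`. -/
theorem ev_chSym_permType (σ : Equiv.Perm (Fin n)) :
    ev (permType σ) (chSym ρ) = LinearMap.trace ℚ X (ρ σ) := by
  have hconj : ∀ σ', permType σ' = permType σ →
      LinearMap.trace ℚ X (ρ σ') = LinearMap.trace ℚ X (ρ σ) := by
    intro σ' h
    rw [permType_eq_ctype, permType_eq_ctype, ctype_eq_iff_isConj, isConj_comm] at h
    obtain ⟨c, rfl⟩ := isConj_iff.1 h
    rw [map_mul, LinearMap.trace_mul_comm, ← map_mul]
    simp
  have hn := card_ctype_mul_zee σ
  rw [Fintype.card_fin] at hn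
  rw [ev_chSym, ← Finset.sum_filter, Finset.sum_congr rfl fun σ' h => by
    rw [hconj σ' (Finset.mem_filter.1 h).2], Finset.sum_const, nsmul_eq_mul]
  refine (congrArg _ ((mul_assoc _ _ _).symm.trans (congrArg (· * _) hn))).trans ?_
  exact inv_mul_cancel_left₀ (by exact_mod_cast n.factorial_ne_zero) _

theorem ev_chSym_of_ne {m : ℕ} (σ : Equiv.Perm (Fin m)) (h : m ≠ n) :
    ev (permType σ) (chSym ρ) = 0 := by
  rw [ev_chSym, Finset.sum_eq_zero, mul_zero]
  intro σ' _
  refine if_neg fun e => h ?_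
  simpa using (card_eq_of_ctype_eq e).symm

end

theorem chSym_of_subsingleton {n : ℕ} {X : Type u} [AddCommGroup X] [Module ℚ X]
    [Subsingleton X] (ρ : Representation ℚ (Equiv.Perm (Fin n)) X) : chSym ρ = 0 := by
  rw [chSym, Finset.sum_eq_zero, smul_zero]
  intro σ _
  rw [Subsingleton.elim (ρ σ) 0, map_zero, zero_smul]

theorem SModule.ev_ch (W : SModule.{u}) {n : ℕ} (σ : Equiv.Perm (Fin n)) :
    ev (permType σ) W.ch = LinearMap.trace ℚ (W.V n) (W.ρ n σ) := by
  obtain ⟨N, hN⟩ := W.bounded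
  have hfin : (Function.support fun m => chSym (W.ρ m)).Finite := by
    refine (Set.finite_lt_nat N).subset fun m hm => ?_
    by_contra h
    have := hN m (not_lt.1 h)
    exact hm (chSym_of_subsingleton _)
  rw [SModule.ch, map_finsum _ hfin, finsum_eq_single _ n, ev_chSym_permType]
  intro m hm
  exact ev_chSym_of_ne _ _ (Ne.symm hm)

/-! ### The values of an `𝕊`-module on finite sets -/

namespace SModule

variable (W : SModule.{u}) {A : Type}

/-- A bijection `{1, …, n} ≃ A` identifies `W[A]` with `W_n`. -/
def objEquiv {n : ℕ} (e : Fin n ≃ A) : W.obj A ≃ₗ[ℚ] W.V n :=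
  LinearEquiv.ofBijective
    { toFun := fun φ : W.obj A => φ.1 n e
      map_add' := fun _ _ => rfl
      map_smul' := fun _ _ => rfl }
    ⟨W.obj_eval_injective e, fun w => by
      have hcard : ∀ {m : ℕ}, (Fin m ≃ A) → m = n := fun {m} e' => by
        simpa using Fintype.card_congr (e'.trans e.symm)
      -- Compatibility with `S_n` forces the family with value `w` at `e`. For `m ≠ n` there is no
      -- bijection `e'`, so the default `0` is never attained.
      refine ⟨⟨fun m e' => if h : m = n then
        h.symm ▸ W.ρ n ((finCongr h.symm).trans (e'.trans e.symm))⁻¹ w else 0, ?_⟩, ?_⟩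
      · intro m e' σ
        obtain rfl := hcard e'
        simp only [dif_pos]
        rw [← Module.End.mul_apply, ← map_mul]
        rfl
      · have : ((finCongr rfl).trans (e.trans e.symm) : Equiv.Perm (Fin n)) = 1 := by
          ext; simp
        change (if h : n = n then h.symm ▸ W.ρ n ((finCongr h.symm).trans (e.trans e.symm))⁻¹ w
          else 0) = w
        rw [dif_pos rfl]
        change W.ρ n ((finCongr rfl).trans (e.trans e.symm))⁻¹ w = w
        rw [this, inv_one, map_one, Module.End.one_apply]⟩

/-- A numbering of `A` conjugates `W.objMap σ` to the action of a permutation of the same type on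
`W_n`, whose trace is read off from the characteristic. -/
theorem trace_objMap [Fintype A] [DecidableEq A] (σ : Equiv.Perm A) :
    LinearMap.trace ℚ (W.obj A) (W.objMap σ) = ev (ctype σ) W.ch := by
  let e : Fin (Fintype.card A) ≃ A := (Fintype.equivFin A).symm
  let σ' : Equiv.Perm (Fin (Fintype.card A)) := e.trans (σ.trans e.symm)
  have h1 : ctype σ = permType σ' := by
    rw [permType_eq_ctype]
    exact ctype_eq_of_equiv e.symm fun x => by simp [σ']
  have h2 : (W.objEquiv e).conj (W.objMap σ) = W.ρ _ σ' := by
    refine LinearMap.ext fun w => ?_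
    obtain ⟨φ, rfl⟩ := (W.objEquiv e).surjective w
    rw [LinearEquiv.conj_apply_apply, LinearEquiv.symm_apply_apply]
    change φ.1 _ (e.trans σ.symm) = W.ρ _ σ' (φ.1 _ e)
    have h3 := φ.2 _ e σ'⁻¹
    rw [inv_inv] at h3
    rw [← h3]
    refine congrArg (φ.1 _) (Equiv.ext fun x => ?_)
    change σ.symm (e x) = e (e.symm (σ.symm (e x)))
    rw [Equiv.apply_symm_apply]
  rw [h1, W.ev_ch, ← h2, LinearMap.trace_conj']

end SModule

/-! ### Traces of permuted tensor powers -/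

section Path

variable {κ : Type*} [Fintype κ] [DecidableEq κ] (N : ℕ → Matrix κ κ ℚ)

/-- The product `N (m - 1) * ⋯ * N 0`. -/
def matPath : ℕ → Matrix κ κ ℚ
  | 0 => 1
  | m + 1 => N m * matPath m

theorem matPath_apply (m : ℕ) (y x : κ) : matPath N m y x =
    ∑ j : Fin (m + 1) → κ, if j 0 = x ∧ j (Fin.last m) = y then
      ∏ i : Fin m, N i (j i.succ) (j i.castSucc) else 0 := by
  induction m generalizing y with
  | zero =>
    rw [matPath, ← (Equiv.funUnique (Fin 1) κ).symm.sum_comp, Matrix.one_apply]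
    change _ = ∑ z : κ, if z = x ∧ z = y then ∏ i : Fin 0, _ else 0
    by_cases h : y = x
    · subst h
      simp
    · rw [if_neg h, Finset.sum_eq_zero]
      intro z _
      exact if_neg fun e => h (e.2.symm.trans e.1)
  | succ m ih =>
    have h0 : ∀ z (j : Fin (m + 1) → κ), (Fin.snocEquiv fun _ => κ) (z, j) 0 = j 0 :=
      fun z j => Fin.snoc_castSucc (α := fun _ => κ) z j 0
    have h1 : ∀ z (j : Fin (m + 1) → κ),
        (Fin.snocEquiv fun _ => κ) (z, j) (Fin.last (m + 1)) = z :=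
      fun z j => Fin.snoc_last (α := fun _ => κ) z j
    have h2 : ∀ z (j : Fin (m + 1) → κ) (i : Fin (m + 1)),
        (Fin.snocEquiv fun _ => κ) (z, j) i.castSucc = j i :=
      fun z j i => Fin.snoc_castSucc (α := fun _ => κ) z j i
    rw [matPath, Matrix.mul_apply]
    symm
    rw [← (Fin.snocEquiv fun _ => κ).sum_comp, Fintype.sum_prod_type, Finset.sum_eq_single y]
    · simp only [ih, Finset.mul_sum]
      rw [Finset.sum_comm]
      refine Finset.sum_congr rfl fun j _ => ?_
      rw [Finset.sum_eq_single (j (Fin.last m)), h0, h1]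
      · by_cases hx : j 0 = x
        · rw [if_pos ⟨hx, rfl⟩, if_pos ⟨hx, rfl⟩, Fin.prod_univ_castSucc, mul_comm]
          congr 1
          · rw [Fin.succ_last, h1, h2]
            rfl
          · refine Finset.prod_congr rfl fun i _ => ?_
            rw [Fin.succ_castSucc, h2, h2]
            rfl
        · rw [if_neg fun h => hx h.1, if_neg fun h => hx h.1, mul_zero]
      · intro z _ hz
        rw [if_neg fun h => hz h.2.symm, mul_zero]
      · simp
    · intro z _ hz
      refine Finset.sum_eq_zero fun j _ => if_neg fun h => hz ?_
      rw [← h.2, h1]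
    · simp

/-- The trace closes the paths of `matPath_apply` into loops, indexed by the `k` vertices. For `k =
0` this would fail: the trace of the identity is the size of `κ`, while the right side is 1. -/
theorem trace_matPath {k : ℕ} (hk : 0 < k) : (matPath N k).trace =
    ∑ j : Fin k → κ, ∏ i : Fin k, N i (j (finRotate k i)) (j i) := by
  obtain ⟨m, rfl⟩ := Nat.exists_eq_succ_of_ne_zero hk.ne'
  simp only [Matrix.trace, Matrix.diag, matPath, Matrix.mul_apply, matPath_apply,
    Finset.mul_sum]
  rw [Finset.sum_congr rfl fun y _ => Finset.sum_comm, Finset.sum_comm]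
  refine Finset.sum_congr rfl fun j _ => ?_
  rw [Finset.sum_eq_single (j 0), Finset.sum_eq_single (j (Fin.last m)), if_pos ⟨rfl, rfl⟩,
    Fin.prod_univ_castSucc, mul_comm]
  · congr 1
    · refine Finset.prod_congr rfl fun i _ => ?_
      rw [finRotate_apply, Fin.coeSucc_eq_succ]
      rfl
    · rw [finRotate_apply, Fin.last_add_one]
      rfl
  · intro z _ hz
    rw [if_neg fun h => hz h.2.symm, mul_zero]
  · simp
  · intro y _ hy
    refine Finset.sum_eq_zero fun z _ => ?_
    rw [if_neg fun h => hy h.1.symm, mul_zero]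
  · simp

end Path

section PermTensor

variable {B : Type*} [Fintype B] [DecidableEq B] {Y : Type*} [AddCommGroup Y] [Module ℚ Y]
  [Module.Finite ℚ Y]

/-- The composite `A (π^m v) ∘ ⋯ ∘ A (π v)`. -/
def cycComp {B Y : Type*} [AddCommGroup Y] [Module ℚ Y] (π : Equiv.Perm B)
    (A : B → Module.End ℚ Y) (v : B) : ℕ → Module.End ℚ Y
  | 0 => 1
  | m + 1 => A ((π ^ (m + 1)) v) * cycComp π A v m

omit [Fintype B] [DecidableEq B] in
theorem pow_finRotate_apply (σ : Equiv.Perm B) (x : B) (i : Fin (Function.minimalPeriod σ x)) :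
    (σ ^ (finRotate _ i : ℕ)) x = σ ((σ ^ (i : ℕ)) x) := by
  have h : ∀ (k : ℕ) (i : Fin k), (finRotate k i : ℕ) = (i + 1) % k := by
    intro k i
    obtain ⟨m, rfl⟩ := Nat.exists_eq_succ_of_ne_zero (Fin.pos i).ne'
    rw [finRotate_apply, Fin.val_add]
    simp
  rw [h, ← Equiv.Perm.iterate_eq_pow, Function.iterate_mod_minimalPeriod_eq,
    Equiv.Perm.iterate_eq_pow, pow_succ', Equiv.Perm.mul_apply]

/-- In a product basis the trace is a sum over labellings `j` of `B` of matrix entries joining `j v`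
to `j (π v)`. It factors over the cycles of `π`, and a cycle contributes the trace of the matrix
product around it. -/
theorem trace_permTensor {Q : Type*} [Fintype Q] [DecidableEq Q] {π : Equiv.Perm B} {out : Q → B}
    (hT : IsTransversal π out) (A : B → Module.End ℚ Y) (T : Module.End ℚ (⨂[ℚ] _ : B, Y))
    (h : ∀ y : B → Y, T (PiTensorProduct.tprod ℚ y) =
      PiTensorProduct.tprod ℚ fun v => A v (y (π.symm v))) :
    LinearMap.trace ℚ _ T =
      ∏ q, LinearMap.trace ℚ Y (cycComp π A (out q) (Function.minimalPeriod π (out q))) := by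
  classical
  let K := Module.Free.ChooseBasisIndex ℚ Y
  let b : Module.Basis K ℚ Y := Module.Free.chooseBasis ℚ Y
  let M : B → Matrix K K ℚ := fun v => LinearMap.toMatrix b b (A v)
  have h1 : LinearMap.trace ℚ _ T = ∑ j : B → K, ∏ v, M (π v) (j (π v)) (j v) := by
    rw [LinearMap.trace_eq_matrix_trace ℚ (Basis.piTensorProduct fun _ : B => b), Matrix.trace]
    refine Finset.sum_congr rfl fun j _ => ?_
    rw [Matrix.diag_apply, LinearMap.toMatrix_apply, Basis.piTensorProduct_apply, h,
      Basis.piTensorProduct_repr_tprod_apply, ← Equiv.prod_comp π]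
    refine Finset.prod_congr rfl fun v _ => ?_
    rw [Equiv.symm_apply_apply]
    exact (LinearMap.toMatrix_apply b b _ _ _).symm
  have h2 : ∀ v m, LinearMap.toMatrix b b (cycComp π A v m) =
      matPath (fun i => M ((π ^ (i + 1)) v)) m := by
    intro v m
    induction m with
    | zero => exact LinearMap.toMatrix_one b
    | succ m ih => rw [cycComp, LinearMap.toMatrix_mul, ih, matPath]
  have h3 : ∀ q, LinearMap.trace ℚ Y (cycComp π A (out q) (Function.minimalPeriod π (out q))) =
      ∑ j : Fin (Function.minimalPeriod π (out q)) → K,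
        ∏ i : Fin (Function.minimalPeriod π (out q)),
        M ((π ^ ((i : ℕ) + 1)) (out q)) (j (finRotate _ i)) (j i) := by
    intro q
    rw [LinearMap.trace_eq_matrix_trace ℚ b, h2, trace_matPath _ (minimalPeriod_perm_pos π _)]
  rw [h1, Finset.prod_congr rfl fun q _ => h3 q, Finset.prod_univ_sum, Fintype.piFinset_univ,
    ← (Equiv.arrowCongr hT.equiv (Equiv.refl K)).sum_comp,
    ← (Equiv.piCurry fun _ _ => K).symm.sum_comp]
  refine Finset.sum_congr rfl fun j _ => ?_
  rw [← hT.equiv.prod_comp, Fintype.prod_sigma]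
  refine Finset.prod_congr rfl fun q _ => Finset.prod_congr rfl fun i _ => ?_
  have h4 : π (hT.equiv ⟨q, i⟩) = hT.equiv ⟨q, finRotate _ i⟩ :=
    (pow_finRotate_apply π (out q) i).symm
  have h5 : (π ^ ((i : ℕ) + 1)) (out q) = π (hT.equiv ⟨q, i⟩) := by
    rw [pow_succ', Equiv.Perm.mul_apply]
    rfl
  have hJ : ∀ p, (Equiv.arrowCongr hT.equiv (Equiv.refl K))
      ((Equiv.piCurry fun _ _ => K).symm j) (hT.equiv p) = j p.1 p.2 := fun p => by
    change (Equiv.piCurry fun _ _ => K).symm j (hT.equiv.symm (hT.equiv p)) = _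
    rw [Equiv.symm_apply_apply]
    rfl
  rw [h5, hJ, h4, hJ]

end PermTensor

/-! ### Equivariant maps between sets with a permutation -/

section Equivariant

open Function

variable {D B K Q : Type*} [Fintype D] [DecidableEq D] [Fintype B] [DecidableEq B]
  [Fintype K] [Fintype Q] [DecidableEq Q] {g : Equiv.Perm D} {π : Equiv.Perm B}
  {outg : K → D} {out : Q → B}

omit [Fintype D] [DecidableEq D] [Fintype B] [DecidableEq B] in
theorem equivariant_pow {c : D → B} (hc : ∀ x, c (g x) = π (c x)) (i : ℕ) (x : D) :
    c ((g ^ i) x) = (π ^ i) (c x) := by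
  induction i with
  | zero => rfl
  | succ i ih => rw [pow_succ', pow_succ', Equiv.Perm.mul_apply, Equiv.Perm.mul_apply, hc, ih]

theorem psing_apply (j : ℕ) (m : ℕ+) : psing j m = if j = m then 1 else 0 := by
  rcases Nat.eq_zero_or_pos j with rfl | hj
  · rw [if_neg m.ne_zero.symm]
    rfl
  · obtain ⟨j, rfl⟩ : ∃ j' : ℕ+, (j' : ℕ) = j := ⟨⟨j, hj⟩, rfl⟩
    rw [psing_coe, Finsupp.single_apply]
    simp only [PNat.coe_inj]

/-- The return map of an equivariant map `c` to the fibre over a point of a cycle of `π` has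
one cycle for each cycle of `g` that `c` sends to this cycle of `π`. -/
theorem ctype_fiber (hS : IsTransversal g outg) (hT : IsTransversal π out) {c : D → B}
    (hc : ∀ x, c (g x) = π (c x)) (q : Q) (σ : Equiv.Perm {x // c x = out q})
    (hσ : ∀ x, (σ x : D) = (g ^ minimalPeriod π (out q)) x) :
    ctype σ = ∑ C, if hT.cyc (c (outg C)) = q then
      psing (minimalPeriod g (outg C) / minimalPeriod π (out q)) else 0 := by
  set k := minimalPeriod π (out q) with hk
  have hkpos : 0 < k := minimalPeriod_perm_pos π _
  have hσn : ∀ (n : ℕ) x, ((σ ^ n) x : D) = (g ^ (k * n)) x := by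
    intro n x
    induction n with
    | zero => rfl
    | succ n ih =>
      rw [pow_succ', Equiv.Perm.mul_apply, hσ, ih, ← Equiv.Perm.mul_apply, ← pow_add, mul_add,
        mul_one, add_comm]
  have hdvd : ∀ x, hT.cyc (c x) = q → k ∣ minimalPeriod g x := by
    intro x hx
    rw [hk, ← hx, hT.minimalPeriod_out_cyc, ← pow_apply_eq_self_iff_dvd, ← equivariant_pow hc,
      (pow_apply_eq_self_iff_dvd g _ x).2 dvd_rfl]
  have hper : ∀ x : {x // c x = out q}, minimalPeriod g (x : D) = k * minimalPeriod σ x := by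
    intro x
    have hx : hT.cyc (c x) = q := by rw [x.2, hT.cyc_out]
    obtain ⟨r, hr⟩ := hdvd x hx
    rw [hr]
    congr 1
    refine Nat.dvd_right_iff_eq.1 fun n => ?_
    rw [← pow_apply_eq_self_iff_dvd σ, Subtype.ext_iff, hσn, pow_apply_eq_self_iff_dvd, hr]
    exact (Nat.mul_dvd_mul_iff_left hkpos).symm
  refine part_ext_of_mul fun m => Nat.eq_of_mul_eq_mul_left hkpos ?_
  -- Points of `g`-period `k * m` over the cycle `q` are counted twice: by fibres, all `k` of which
  -- have the same size since `g` permutes them, and by cycles of `g`.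
  let N : B → ℕ := fun b => Fintype.card {x // c x = b ∧ minimalPeriod g x = k * m}
  have hN : ∀ b, N (π b) = N b := by
    intro b
    refine Fintype.card_congr (g.subtypeEquiv fun x => ?_).symm
    have : minimalPeriod g (g x) = minimalPeriod g x := minimalPeriod_pow_apply g 1 x
    rw [hc, π.injective.eq_iff, this]
  have h1 : (m : ℕ) * ctype σ m = N (out q) := by
    rw [mul_ctype]
    refine Fintype.card_congr ((Equiv.subtypeSubtypeEquivSubtypeInter (fun x => c x = out q)
      fun x => minimalPeriod g x = k * m).symm.trans
        (Equiv.subtypeEquivRight fun x => ?_)).symm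
    rw [hper x, Nat.mul_right_inj hkpos.ne']
  have h2 : ∑ x, (if hT.cyc (c x) = q ∧ minimalPeriod g x = k * m then 1 else 0) =
      k * N (out q) := by
    have e1 : ∑ x, (if hT.cyc (c x) = q ∧ minimalPeriod g x = k * m then 1 else 0) =
        ∑ b, if hT.cyc b = q then N b else 0 := by
      have : ∀ b, (if hT.cyc b = q then N b else 0) =
          ∑ x, if c x = b then (if hT.cyc (c x) = q ∧ minimalPeriod g x = k * m then 1 else 0)
            else 0 := by
        intro b
        simp only [N, Fintype.card_subtype, Finset.card_filter]
        split_ifs with h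
        · refine Finset.sum_congr rfl fun x _ => ?_
          by_cases hx : c x = b
          · simp [hx, h]
          · simp [hx]
        · refine (Finset.sum_eq_zero fun x _ => ?_).symm
          by_cases hx : c x = b
          · simp [hx, h]
          · simp [hx]
      simp only [this]
      rw [Finset.sum_comm]
      simp
    rw [e1, hT.sum_eq_of_const _ fun b => by rw [hT.cyc_apply, hN], Finset.sum_eq_single q]
    · rw [hT.cyc_out, if_pos rfl, smul_eq_mul]
    · intro q' _ hq'
      rw [hT.cyc_out, if_neg hq', smul_zero]
    · simp
  have h3 : ∑ x, (if hT.cyc (c x) = q ∧ minimalPeriod g x = k * m then 1 else 0) =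
      k * (m * (∑ C, if hT.cyc (c (outg C)) = q then
        psing (minimalPeriod g (outg C) / k) else 0 : Part) m) := by
    rw [hS.sum_eq_of_const, Finsupp.finsetSum_apply, Finset.mul_sum, Finset.mul_sum]
    · refine Finset.sum_congr rfl fun C _ => ?_
      by_cases hC : hT.cyc (c (outg C)) = q
      · obtain ⟨r, hr⟩ := hdvd _ hC
        rw [if_pos hC, psing_apply, hr, Nat.mul_div_cancel_left _ hkpos]
        by_cases hrm : r = m
        · rw [if_pos ⟨hC, by rw [hrm]⟩, if_pos hrm, hrm, smul_eq_mul]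
          ring
        · rw [if_neg fun e => hrm (Nat.eq_of_mul_eq_mul_left hkpos e.2), if_neg hrm]
          simp
      · rw [if_neg fun e => hC e.1, if_neg hC]
        simp
    · intro x
      have : minimalPeriod g (g x) = minimalPeriod g x := minimalPeriod_pow_apply g 1 x
      rw [hc, hT.cyc_apply, this]
  rw [h1, ← h2, h3]

/-- Equivariant maps are determined by the images of representatives of the cycles. -/
theorem sum_equivariant [DecidableEq K] (hS : IsTransversal g outg) {M : Type*} [AddCommMonoid M]
    (F : (K → B) → M) :
    ∑ c : D → B with ∀ x, c (g x) = π (c x), F (c ∘ outg) =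
      ∑ β ∈ Fintype.piFinset fun C => Finset.univ.filter fun b =>
        (π ^ (perLen g (outg C) : ℕ)) b = b, F β := by
  refine Finset.sum_nbij (fun c => c ∘ outg) ?_ ?_ ?_ fun _ _ => rfl
  · intro c hc
    replace hc := (Finset.mem_filter.1 hc).2
    rw [Fintype.mem_piFinset]
    intro C
    rw [Finset.mem_filter]
    refine ⟨Finset.mem_univ _, ?_⟩
    rw [Function.comp_apply, ← equivariant_pow hc, perLen_coe,
      (pow_apply_eq_self_iff_dvd g _ _).2 dvd_rfl]
  · intro c hc c' hc' h
    replace hc := (Finset.mem_filter.1 hc).2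
    replace hc' := (Finset.mem_filter.1 hc').2
    funext x
    obtain ⟨i, _, hi⟩ := hS.exists_pow x
    rw [← hi, equivariant_pow hc, equivariant_pow hc']
    exact congrArg _ (congrFun h _)
  · intro β hβ
    have hβ' : ∀ C, minimalPeriod π (β C) ∣ minimalPeriod g (outg C) := fun C => by
      rw [← pow_apply_eq_self_iff_dvd]
      exact (Finset.mem_filter.1 (Fintype.mem_piFinset.1 hβ C)).2
    -- Equivariance forces `g ^ i (outg C) ↦ π ^ i (β C)`; this is well defined because the length
    -- of the cycle of `β C` divides that of `C`.
    let c : D → B := fun x => (π ^ ((hS.equiv.symm x).2 : ℕ)) (β (hS.cyc x))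
    have hcpow : ∀ (i : ℕ) C, c ((g ^ i) (outg C)) = (π ^ i) (β C) := by
      intro i C
      have h : hS.equiv ⟨C, ⟨i % _, Nat.mod_lt _ (minimalPeriod_perm_pos g (outg C))⟩⟩ =
          (g ^ i) (outg C) := by
        rw [IsTransversal.equiv_apply, ← Equiv.Perm.iterate_eq_pow, ← Equiv.Perm.iterate_eq_pow]
        exact iterate_mod_minimalPeriod_eq
      simp only [c, IsTransversal.cyc]
      rw [← h, Equiv.symm_apply_apply]
      change (π ^ (i % minimalPeriod g (outg C))) (β C) = _
      conv_rhs => rw [← Nat.mod_add_div i (minimalPeriod g (outg C)), pow_add,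
        Equiv.Perm.mul_apply,
        (pow_apply_eq_self_iff_dvd π _ _).2 ((hβ' C).trans (Dvd.intro _ rfl))]
    refine ⟨c, Finset.mem_coe.2 (Finset.mem_filter.2 ⟨Finset.mem_univ _, fun x => ?_⟩),
      funext fun C => hcpow 0 C⟩
    obtain ⟨i, _, hi⟩ := hS.exists_pow x
    rw [← hi, hcpow, ← Equiv.Perm.mul_apply, ← pow_succ', hcpow, pow_succ',
      Equiv.Perm.mul_apply]

/-- The indices in the expansion of the iterated derivative are choices, for each cycle of `g`, of a
point fixed by the corresponding power of `π`: exactly the data of an equivariant map. -/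
theorem ev_ctype_adamsProd [DecidableEq K] (hS : IsTransversal g outg)
    (hT : IsTransversal π out) (f : Q → Lam) :
    ev (ctype g) (∏ q, psi (perLen π (out q)) (f q)) =
      ∑ c : D → B with ∀ x, c (g x) = π (c x), ∏ q,
        ev (∑ C, if hT.cyc (c (outg C)) = q then
          psing (minimalPeriod g (outg C) / minimalPeriod π (out q)) else 0) (f q) := by
  rw [hS.ctype_eq, ev_sum_adamsProd (fun q => perLen π (out q)) f hT.cyc
    (fun l => Finset.univ.filter fun b => (π ^ (l : ℕ)) b = b)]
  · exact (sum_equivariant hS fun β => ∏ q, ev (∑ C, if hT.cyc (β C) = q then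
      psing (minimalPeriod g (outg C) / minimalPeriod π (out q)) else 0) (f q)).symm
  · intro l G
    rw [hT.sum_filter_pow]
    refine Finset.sum_congr rfl fun q _ => ?_
    simp only [perLen_coe, Nat.cast_smul_eq_nsmul]

end Equivariant

/-! ### The character of `W^{⊗ν}` -/

theorem trace_directSum {ι : Type*} [DecidableEq ι] {M : ι → Type*} [∀ i, AddCommGroup (M i)]
    [∀ i, Module ℚ (M i)] [∀ i, Module.Finite ℚ (M i)] (S : Finset ι)
    (hS : ∀ i, i ∉ S → Subsingleton (M i)) [Module.Finite ℚ (⨁ i, M i)]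
    (T : Module.End ℚ (⨁ i, M i)) :
    LinearMap.trace ℚ _ T = ∑ i ∈ S, LinearMap.trace ℚ (M i)
      (DirectSum.component ℚ ι M i ∘ₗ T ∘ₗ DirectSum.lof ℚ ι M i) := by
  have h : T = ∑ i ∈ S, (T ∘ₗ DirectSum.lof ℚ ι M i) ∘ₗ DirectSum.component ℚ ι M i := by
    refine DirectSum.linearMap_ext ℚ fun i => LinearMap.ext fun x => ?_
    by_cases hi : i ∈ S
    · simp only [LinearMap.comp_apply, LinearMap.sum_apply]
      rw [Finset.sum_eq_single i, DirectSum.component.lof_self]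
      · intro j _ hj
        rw [DirectSum.component.of, dif_neg hj.symm, map_zero, map_zero]
      · exact fun h => absurd hi h
    · have := hS i hi
      rw [Subsingleton.elim x 0, map_zero, map_zero]
  conv_lhs => rw [h, map_sum]
  exact Finset.sum_congr rfl fun i _ => LinearMap.trace_comp_comm' _ _

section TensorTrace

variable (W : SModule.{u}) {ν : GenPart} {n : ℕ}

/-- The labels of the tensor factor `v` for the distribution `c`. -/
abbrev Lab (p : (Fin n → Factor ν) × Factor ν) : Type := Fin p.2.1 ⊕ {x // p.1 x = p.2}

/-- The product of the spaces of all tensor factors for all distributions. -/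
abbrev FactorSpace (ν : GenPart) (n : ℕ) : Type u :=
  ∀ p : (Fin n → Factor ν) × Factor ν, W.obj (Lab p)

/-- The inclusion of a factor. -/
def inc (p : (Fin n → Factor ν) × Factor ν) : W.obj (Lab p) →ₗ[ℚ] FactorSpace W ν n :=
  LinearMap.single ℚ (fun p : (Fin n → Factor ν) × Factor ν => W.obj (Lab p)) p

/-- The projection to a factor. -/
def prj (p : (Fin n → Factor ν) × Factor ν) : FactorSpace W ν n →ₗ[ℚ] W.obj (Lab p) :=
  LinearMap.proj p

theorem prj_comp_inc (p : (Fin n → Factor ν) × Factor ν) : prj W p ∘ₗ inc W p = LinearMap.id :=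
  LinearMap.proj_comp_single_same ℚ _ p

theorem prj_inc_apply (p : (Fin n → Factor ν) × Factor ν) (x : W.obj (Lab p)) :
    prj W p (inc W p x) = x := LinearMap.congr_fun (prj_comp_inc W p) x

/-- The action of `(τ, g)` from the factor `τ⁻¹ v` for `c` to the factor `v` for the moved
distribution. -/
def factorAct (a : SGrp ν × Equiv.Perm (Fin n)) (c : Fin n → Factor ν) (v : Factor ν) :
    Module.End ℚ (FactorSpace W ν n) :=
  inc W (moveDist a c, v) ∘ₗ W.objMap (moveLabels a c v) ∘ₗ prj W (c, (factorPerm a.1).symm v)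

theorem factorAct_mul (a b : SGrp ν × Equiv.Perm (Fin n)) (c : Fin n → Factor ν) (v : Factor ν) :
    factorAct W (a * b) c v =
      factorAct W a (moveDist b c) v * factorAct W b c ((factorPerm a.1).symm v) := by
  refine LinearMap.ext fun y => ?_
  change inc W (moveDist (a * b) c, v) (W.objMap (moveLabels (a * b) c v)
      (prj W (c, (factorPerm (a * b).1).symm v) y)) =
    inc W (moveDist a (moveDist b c), v) (W.objMap (moveLabels a (moveDist b c) v)
      (prj W (moveDist b c, (factorPerm a.1).symm v)
        (inc W (moveDist b c, (factorPerm a.1).symm v) (W.objMap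
        (moveLabels b c ((factorPerm a.1).symm v))
          (prj W (c, (factorPerm b.1).symm ((factorPerm a.1).symm v)) y)))))
  rw [prj_inc_apply, moveLabels_mul]
  rfl

theorem moveDist_pow {a : SGrp ν × Equiv.Perm (Fin n)} {c : Fin n → Factor ν}
    (h : moveDist a c = c) (m : ℕ) : moveDist (a ^ m) c = c := by
  induction m with
  | zero => rfl
  | succ m ih =>
    rw [pow_succ]
    change moveDist (a ^ m) (moveDist a c) = c
    rw [h, ih]

/-- Since `c` is fixed, consecutive steps stay in the factors of `c` and compose to a power of `a`.
At least one step is needed: the empty composite is the identity, whereas `factorAct W 1 c v` is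
only a projection to one factor. -/
theorem cycComp_factorAct {a : SGrp ν × Equiv.Perm (Fin n)} {c : Fin n → Factor ν}
    (h : moveDist a c = c) (v : Factor ν) (m : ℕ) :
    cycComp (factorPerm a.1) (factorAct W a c) v (m + 1) =
      factorAct W (a ^ (m + 1)) c ((factorPerm a.1 ^ (m + 1)) v) := by
  induction m with
  | zero => rw [cycComp, cycComp, mul_one, zero_add, pow_one, pow_one]
  | succ m ih =>
    rw [cycComp, ih, pow_succ' a (m + 1), factorAct_mul, moveDist_pow h]
    congr 2
    rw [Equiv.eq_symm_apply, pow_succ' _ (m + 1), Equiv.Perm.mul_apply]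

/-- The underlying label. -/
def labVal (p : (Fin n → Factor ν) × Factor ν) : Lab p → ℕ ⊕ Fin n :=
  Sum.map (fun i => (i : ℕ)) Subtype.val

theorem labVal_injective (p : (Fin n → Factor ν) × Factor ν) :
    Function.Injective (labVal p) :=
  Sum.map_injective.2 ⟨Fin.val_injective, Subtype.val_injective⟩

/-- The source and target label sets agree only up to propositional equality of indices, so the
bijections are compared through underlying labels instead of transports. -/
theorem trace_inc_prj {p p' p₀ : (Fin n → Factor ν) × Factor ν} (hp : p = p₀) (hp' : p' = p₀)
    (e : Lab p ≃ Lab p') (σ : Equiv.Perm (Lab p₀))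
    (h : ∀ y y', labVal p y = labVal p₀ y' → labVal p' (e y) = labVal p₀ (σ y')) :
    LinearMap.trace ℚ (FactorSpace W ν n) (inc W p' ∘ₗ W.objMap e ∘ₗ prj W p) =
      ev (ctype σ) W.ch := by
  subst hp hp'
  obtain rfl : e = σ := Equiv.ext fun y => labVal_injective _ (h y y rfl)
  rw [LinearMap.trace_comp_comm', LinearMap.comp_assoc, prj_comp_inc, LinearMap.comp_id,
    SModule.trace_objMap]

/-- The tensor factors are different spaces. Embedding them all as retracts of `FactorSpace` keeps
the trace, by cyclicity, and yields a tensor power of a single space, to which `trace_permTensor`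
applies. -/
theorem trace_component_lof_comp {c c' : Fin n → Factor ν} (h : c' = c)
    (f : Comp W ν n c →ₗ[ℚ] Comp W ν n c') :
    LinearMap.trace ℚ (Comp W ν n c)
      (DirectSum.component ℚ _ (Comp W ν n) c ∘ₗ DirectSum.lof ℚ _ (Comp W ν n) c' ∘ₗ f) =
    LinearMap.trace ℚ (⨂[ℚ] _ : Factor ν, FactorSpace W ν n)
      (PiTensorProduct.map (fun v => inc W (c', v)) ∘ₗ f ∘ₗ
        PiTensorProduct.map fun v => prj W (c, v)) := by
  subst h
  have h1 : DirectSum.component ℚ _ (Comp W ν n) c' ∘ₗ DirectSum.lof ℚ _ (Comp W ν n) c' =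
      LinearMap.id := LinearMap.ext fun x => DirectSum.component.lof_self ℚ _ _
  have h2 : (PiTensorProduct.map fun v => prj W (c', v)) ∘ₗ
      (PiTensorProduct.map fun v => inc W (c', v)) =
      (LinearMap.id : Comp W ν n c' →ₗ[ℚ] Comp W ν n c') := by
    rw [← PiTensorProduct.map_comp]
    simp only [prj_comp_inc]
    exact PiTensorProduct.map_id
  rw [← LinearMap.comp_assoc, h1, LinearMap.id_comp]
  have : Module.Free ℚ (⨂[ℚ] _ : Factor ν, FactorSpace W ν n) :=
    Module.Free.of_basis (Basis.piTensorProduct fun _ => Module.Free.chooseBasis ℚ _)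
  have : Module.Free ℚ (Comp W ν n c') :=
    Module.Free.of_basis (Basis.piTensorProduct fun _ => Module.Free.chooseBasis ℚ _)
  refine Eq.symm ((LinearMap.trace_comp_comm' (R := ℚ) (N := Comp W ν n c')
    (M := ⨂[ℚ] _ : Factor ν, FactorSpace W ν n) (f ∘ₗ PiTensorProduct.map fun v =>
    prj W (c', v)) (PiTensorProduct.map fun v => inc W (c', v))).trans ?_)
  exact congrArg _ ((LinearMap.comp_assoc _ _ _).trans
    ((congrArg (f ∘ₗ ·) h2).trans (LinearMap.comp_id f)))

/-- The summand of `c` is carried to that of `moveDist a c`, so only fixed distributions have a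
nonzero diagonal block; there the permuted tensor product splits along cycles. -/
theorem trace_tensorAct {Q : Type*} [Fintype Q] [DecidableEq Q]
    (a : SGrp ν × Equiv.Perm (Fin n)) {out : Q → Factor ν}
    (hT : IsTransversal (factorPerm a.1) out) :
    LinearMap.trace ℚ _ (tensorAct W a) =
      ∑ c : Fin n → Factor ν with ∀ x, c (a.2 x) = factorPerm a.1 (c x),
        ∏ q, LinearMap.trace ℚ _
          (factorAct W (a ^ Function.minimalPeriod (factorPerm a.1) (out q)) c (out q)) := by
  have hiff : ∀ c : Fin n → Factor ν,
      (∀ x, c (a.2 x) = factorPerm a.1 (c x)) ↔ moveDist a c = c := by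
    intro c
    constructor
    · intro h
      funext x
      rw [moveDist, ← h]
      simp
    · intro h x
      conv_lhs => rw [← h, moveDist]
      simp
  rw [Finset.sum_filter]
  refine (trace_directSum (M := Comp W ν n) Finset.univ
    (fun c hc => absurd (Finset.mem_univ c) hc) (tensorAct W a)).trans ?_
  refine Finset.sum_congr rfl fun c _ => ?_
  have h1 : tensorAct W a ∘ₗ DirectSum.lof ℚ _ (Comp W ν n) c =
      DirectSum.lof ℚ _ (Comp W ν n) (moveDist a c) ∘ₗ compAct W a c :=
    LinearMap.ext fun x => DirectSum.toModule_lof _ _ _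
  rw [h1]
  by_cases hc : moveDist a c = c
  · rw [if_pos ((hiff c).2 hc), trace_component_lof_comp W hc,
      trace_permTensor hT (factorAct W a c)]
    · refine Finset.prod_congr rfl fun q _ => ?_
      obtain ⟨m, hm⟩ := Nat.exists_eq_succ_of_ne_zero
        (minimalPeriod_perm_pos (factorPerm a.1) (out q)).ne'
      have h2 := (pow_apply_eq_self_iff_dvd (factorPerm a.1) _ (out q)).2 dvd_rfl
      rw [hm] at h2 ⊢
      rw [Nat.succ_eq_add_one, cycComp_factorAct W hc, h2]
    · intro y
      simp only [LinearMap.comp_apply, PiTensorProduct.map_tprod, compAct,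
        LinearEquiv.coe_coe, PiTensorProduct.reindex_tprod]
      rfl
  · rw [if_neg (mt (hiff c).1 hc)]
    have h2 : DirectSum.component ℚ _ (Comp W ν n) c ∘ₗ
        DirectSum.lof ℚ _ (Comp W ν n) (moveDist a c) = 0 :=
      LinearMap.ext fun x => by
        rw [LinearMap.comp_apply, DirectSum.component.of, dif_neg hc, LinearMap.zero_apply]
    rw [← LinearMap.comp_assoc, h2, LinearMap.zero_comp, map_zero]

/-! ### Comparison with the action of `Λ^{[2]}` -/

theorem factorPerm_pow (τ : SGrp ν) (m : ℕ) : factorPerm (τ ^ m) = factorPerm τ ^ m := by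
  induction m with
  | zero => rfl
  | succ m ih =>
    rw [pow_succ, pow_succ, ← ih]
    rfl

theorem factorPerm_pow_apply (τ : SGrp ν) (m : ℕ) (i : ν.support) (x : Fin (ν i)) :
    (factorPerm τ ^ m) ⟨i, x⟩ = ⟨i, ((τ i).right ^ m) x⟩ := by
  induction m with
  | zero => rfl
  | succ m ih => rw [pow_succ', Equiv.Perm.mul_apply, ih, pow_succ']; rfl

theorem perLen_factorPerm (τ : SGrp ν) (i : ν.support) (x : Fin (ν i)) :
    perLen (factorPerm τ) (⟨i, x⟩ : Factor ν) = cycleLen (τ i).right x :=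
  PNat.eq (minimalPeriod_eq_of_iff fun n => by
    rw [factorPerm_pow_apply]
    simp)

theorem pTwoPart_add (Θ Θ' : TwoPart) : pTwoPart (Θ + Θ') = pTwoPart Θ * pTwoPart Θ' := by
  classical
  refine Finsupp.prod_add_index' (fun μ => ?_) fun μ l l' => ?_
  · rfl
  · exact Finsupp.prod_add_index' (fun i => pow_zero _) fun i m m' => pow_add _ _ _

theorem pTwoPart_sum {ι : Type*} (s : Finset ι) (Θ : ι → TwoPart) :
    pTwoPart (∑ i ∈ s, Θ i) = ∏ i ∈ s, pTwoPart (Θ i) := by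
  classical
  induction s using Finset.induction_on with
  | empty => rfl
  | insert i s hi ih => rw [Finset.sum_insert hi, Finset.prod_insert hi, pTwoPart_add, ih]

theorem pTwoPart_single (μ : Part) (k : ℕ+) :
    pTwoPart (Finsupp.single μ (Finsupp.single k 1)) = MvPolynomial.X (k, μ) := by
  rw [pTwoPart, Finsupp.prod_single_index (by rfl)]
  exact (Finsupp.prod_single_index (h := fun i m => (MvPolynomial.X (i, μ) : Lam2) ^ m)
    (pow_zero _)).trans (pow_one _)

theorem tcirc_pTwoPart_twoType (τ : SGrp ν) (f : Lam) : tcirc (pTwoPart (twoType τ)) f =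
    ∏ q : Σ i : ν.support, Quotient (Equiv.Perm.SameCycle.setoid (τ i).right),
      psi (cycleLen (τ q.1).right q.2.out) (skew (permType (cycleProd (τ q.1) q.2.out)) f) := by
  rw [twoType, pTwoPart_sum, Fintype.prod_sigma]
  simp only [pTwoPart_sum, pTwoPart_single, tcirc, map_prod, MvPolynomial.aeval_X]

/-- Both sides are sums over equivariant `c` of products over the cycles of the factor permutation.
The factors agree because the return map has the type of the cycle product plus the type of the
return map on the fibre. -/
theorem trace_tensorAct_eq_ev (τ : SGrp ν) (g : Equiv.Perm (Fin n)) :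
    LinearMap.trace ℚ _ (tensorAct W (τ, g)) =
      ev (permType g) (tcirc (pTwoPart (twoType τ)) W.ch) := by
  classical
  have hT : IsTransversal (factorPerm τ)
      (fun q : Σ i : ν.support, Quotient (Equiv.Perm.SameCycle.setoid (τ i).right) =>
        (⟨q.1, q.2.out⟩ : Factor ν)) :=
    isTransversal_sigma (fun i => (τ i).right) (fun i => Quotient.out)
      fun i => isTransversal_out (τ i).right
  have hS := isTransversal_out g
  rw [trace_tensorAct W (τ, g) hT, tcirc_pTwoPart_twoType, permType_eq_ctype]
  have hlen : ∀ q : Σ i : ν.support, Quotient (Equiv.Perm.SameCycle.setoid (τ i).right),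
      cycleLen (τ q.1).right q.2.out = perLen (factorPerm τ) (⟨q.1, q.2.out⟩ : Factor ν) :=
    fun q => (perLen_factorPerm τ q.1 q.2.out).symm
  simp only [hlen]
  rw [ev_ctype_adamsProd hS hT]
  refine Finset.sum_congr (by ext; simp) fun c hc => Finset.prod_congr rfl fun q _ => ?_
  replace hc : ∀ x, c (g x) = factorPerm τ (c x) := by simpa using hc
  set k := Function.minimalPeriod (factorPerm τ) (⟨q.1, q.2.out⟩ : Factor ν) with hk
  have hfix : (factorPerm τ ^ k) ⟨q.1, q.2.out⟩ = (⟨q.1, q.2.out⟩ : Factor ν) :=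
    (pow_apply_eq_self_iff_dvd _ _ _).2 dvd_rfl
  -- The return map of `g` to the fibre: `g ^ k` preserves it since `k` steps bring the factor back
  -- to itself.
  let σ : Equiv.Perm {x // c x = ⟨q.1, q.2.out⟩} := (g ^ k).subtypePerm fun x => by
    rw [equivariant_pow hc]
    conv_lhs => rw [← hfix, (factorPerm τ ^ k).injective.eq_iff]
  rw [← ctype_fiber hS hT hc q σ fun x => rfl, ev_skew, permType_eq_ctype, add_comm,
    ← ctype_sumCongr]
  have hmove : moveDist (τ, g) c = c := funext fun x => by
    rw [moveDist, ← hc]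
    simp
  have hfix' : (factorPerm ((τ, g) ^ k).1).symm ⟨q.1, q.2.out⟩ = (⟨q.1, q.2.out⟩ : Factor ν) := by
    rw [Equiv.symm_apply_eq, Prod.pow_fst, factorPerm_pow, hfix]
  refine trace_inc_prj W (p := (c, (factorPerm ((τ, g) ^ k).1).symm ⟨q.1, q.2.out⟩))
    (p' := (moveDist ((τ, g) ^ k) c, ⟨q.1, q.2.out⟩)) (p₀ := (c, ⟨q.1, q.2.out⟩))
    (Prod.ext rfl hfix')
    (Prod.ext (moveDist_pow hmove k) rfl) _
    (Equiv.sumCongr (cycleProd (τ q.1) q.2.out) σ) ?_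
  have hprod : (((τ, g) ^ k).1 q.1).left q.2.out = cycleProd (τ q.1) q.2.out := by
    rw [cycleProd, ← perLen_factorPerm]
    rfl
  rintro (i | x) (i' | x') h
  · obtain rfl : i = i' := Fin.ext (Sum.inl_injective h)
    exact congrArg Sum.inl (congrArg Fin.val (Equiv.congr_fun hprod i))
  · cases h
  · cases h
  · have hx : (x : Fin n) = x' := Sum.inr_injective h
    refine congrArg Sum.inr ?_
    change ((τ, g) ^ k).2 x = (g ^ k) x'
    rw [hx]
    rfl

end TensorTrace

/-! ### The character of `T_V(W)` -/

theorem cycleProd_inv {m k : ℕ} (τ : Wreath m k) (x : Fin k) :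
    cycleProd τ⁻¹ x = (cycleProd τ x)⁻¹ := by
  have hlen : cycleLen (τ⁻¹).right x = cycleLen τ.right x :=
    PNat.eq (minimalPeriod_eq_of_iff fun n => by
      rw [SemidirectProduct.inv_right, inv_pow, Equiv.Perm.inv_eq_iff_eq, eq_comm])
  have hr : ∀ j : ℕ, (τ ^ j).right = τ.right ^ j := fun j =>
    map_pow (SemidirectProduct.rightHom : Wreath m k →* Equiv.Perm (Fin k)) τ j
  rw [cycleProd, cycleProd, hlen, inv_pow, SemidirectProduct.inv_left, hr]
  change ((τ ^ (cycleLen τ.right x : ℕ)).left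
    ((τ.right ^ (cycleLen τ.right x : ℕ))⁻¹⁻¹ x))⁻¹ = _
  have h : (τ.right ^ (cycleLen τ.right x : ℕ)) x = x :=
    (pow_apply_eq_self_iff_dvd _ _ _).2 (dvd_refl _)
  rw [inv_inv, h]

theorem twoType_inv {ν : GenPart} (τ : SGrp ν) : twoType τ⁻¹ = twoType τ := by
  -- A permutation and its inverse have equal cycle relations, but the quotients are different
  -- types, so the sums are identified by substituting an equality of setoids.
  have key : ∀ {m : ℕ} (s s' : Setoid (Fin m)) (_ : Fintype (Quotient s))
      (_ : Fintype (Quotient s')) (_ : s = s') (F : Fin m → TwoPart),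
      ∑ q : Quotient s, F q.out = ∑ q : Quotient s', F q.out := by
    intro m s s' i i' h F
    subst h
    rw [Subsingleton.elim i i']
  refine Finset.sum_congr rfl fun i _ => ?_
  have hF : ∀ x : Fin (ν i), Finsupp.single (permType (cycleProd (τ⁻¹ i) x))
      (Finsupp.single (cycleLen (τ⁻¹ i).right x) 1) =
      Finsupp.single (permType (cycleProd (τ i) x))
        (Finsupp.single (cycleLen (τ i).right x) 1) := by
    intro x
    have hlen : cycleLen (τ⁻¹ i).right x = cycleLen (τ i).right x :=
      PNat.eq (minimalPeriod_eq_of_iff fun n => by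
        rw [Pi.inv_apply, SemidirectProduct.inv_right, inv_pow, Equiv.Perm.inv_eq_iff_eq, eq_comm])
    rw [hlen, Pi.inv_apply, cycleProd_inv, permType_eq_ctype, ctype_inv, permType_eq_ctype]
  simp only [hF]
  refine key _ _ _ _ (Setoid.ext fun x y => ?_) fun x =>
    Finsupp.single (permType (cycleProd (τ i) x)) (Finsupp.single (cycleLen (τ i).right x) 1)
  exact Equiv.Perm.sameCycle_inv

theorem trace_comp_comm_rat {M N : Type*} [AddCommMonoid M] [Module ℚ M] [AddCommMonoid N]
    [Module ℚ N] [Module.Finite ℚ M] [Module.Finite ℚ N] (f : M →ₗ[ℚ] N) (g : N →ₗ[ℚ] M) :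
    LinearMap.trace ℚ M (g ∘ₗ f) = LinearMap.trace ℚ N (f ∘ₗ g) := by
  let _ : AddCommGroup M := Module.addCommMonoidToAddCommGroup ℚ
  let _ : AddCommGroup N := Module.addCommMonoidToAddCommGroup ℚ
  exact LinearMap.trace_comp_comm' f g

/-! ### Averaging and traces on spaces of intertwining maps -/

section Intertwining

variable {G H X U : Type*} [Group G] [Fintype G] [Group H] [AddCommGroup X] [Module ℚ X]
  [AddCommGroup U] [Module ℚ U] (ρ : Representation ℚ G X) (θ : Representation ℚ (G × H) U)

/-- The average over `G` of a linear map between representations of `G`. -/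
def homAverage :
    (X →ₗ[ℚ] U) →ₗ[ℚ] ρ.IntertwiningMap (θ.comp (MonoidHom.inl G H)) where
  toFun f := ⟨((Fintype.card G : ℚ)⁻¹) • ∑ τ : G, θ (τ, 1) ∘ₗ f ∘ₗ ρ τ⁻¹, fun κ => by
    change _ = θ (κ, 1) ∘ₗ _
    rw [LinearMap.smul_comp, LinearMap.comp_smul]
    congr 1
    refine LinearMap.ext fun x => ?_
    simp only [LinearMap.comp_apply, LinearMap.sum_apply, map_sum]
    rw [← Equiv.sum_comp (Equiv.mulLeft κ)]
    refine Finset.sum_congr rfl fun τ _ => ?_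
    rw [Equiv.coe_mulLeft, ← Module.End.mul_apply (ρ _), ← Module.End.mul_apply (θ _), ← map_mul,
      ← map_mul, Prod.mk_mul_mk, mul_one, mul_inv_rev, inv_mul_cancel_right]⟩
  map_add' f f' := by
    apply Representation.IntertwiningMap.ext
    simp only [LinearMap.add_comp, LinearMap.comp_add, Finset.sum_add_distrib, smul_add]
    rfl
  map_smul' c f := by
    apply Representation.IntertwiningMap.ext
    simp only [LinearMap.smul_comp, LinearMap.comp_smul, ← Finset.smul_sum]
    rw [smul_comm]
    rfl

theorem homAverage_toLinearMap (f : X →ₗ[ℚ] U) : (homAverage ρ θ f).toLinearMap =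
    ((Fintype.card G : ℚ)⁻¹) • ∑ τ : G, θ (τ, 1) ∘ₗ f ∘ₗ ρ τ⁻¹ := rfl

/-- Factor `E` as the average after `L`, the inclusion into all linear maps followed by `θ (1, h)`.
Cyclicity moves the trace to the full Hom space, where `L` after the average is a mean of operators
`f ↦ θ (τ, h) ∘ f ∘ ρ τ⁻¹`, with known traces. -/
theorem trace_intertwiningMap [Module.Finite ℚ X] [Module.Finite ℚ U]
    [Module.Finite ℚ (ρ.IntertwiningMap (θ.comp (MonoidHom.inl G H)))] (h : H)
    (E : Module.End ℚ (ρ.IntertwiningMap (θ.comp (MonoidHom.inl G H))))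
    (hE : ∀ f, (E f).toLinearMap = θ (1, h) ∘ₗ f.toLinearMap) :
    LinearMap.trace ℚ _ E = ((Fintype.card G : ℚ)⁻¹) *
      ∑ τ : G, LinearMap.trace ℚ X (ρ τ⁻¹) * LinearMap.trace ℚ U (θ (τ, h)) := by
  let L : ρ.IntertwiningMap (θ.comp (MonoidHom.inl G H)) →ₗ[ℚ] (X →ₗ[ℚ] U) :=
    { toFun := fun f => θ (1, h) ∘ₗ f.toLinearMap
      map_add' := fun _ _ => LinearMap.comp_add _ _ _
      map_smul' := fun _ _ => LinearMap.comp_smul _ _ _ }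
  have h1 : E = homAverage ρ θ ∘ₗ L := by
    refine LinearMap.ext fun f => Representation.IntertwiningMap.ext ?_
    -- The actions of `G` and `H` commute, so `θ (1, h) ∘ f` is still intertwining and averaging
    -- leaves it unchanged.
    have key : ∀ τ : G, θ (τ, 1) ∘ₗ (θ (1, h) ∘ₗ f.toLinearMap) ∘ₗ ρ τ⁻¹ =
        θ (1, h) ∘ₗ f.toLinearMap := by
      intro τ
      rw [LinearMap.comp_assoc, f.isIntertwining', ← LinearMap.comp_assoc,
        ← LinearMap.comp_assoc]
      congr 1
      change θ (τ, 1) * θ (1, h) * θ (τ⁻¹, 1) = θ (1, h)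
      rw [← map_mul, ← map_mul]
      simp
    rw [hE, LinearMap.comp_apply, homAverage_toLinearMap]
    change _ = _ • ∑ τ : G, θ (τ, 1) ∘ₗ (θ (1, h) ∘ₗ f.toLinearMap) ∘ₗ ρ τ⁻¹
    rw [Finset.sum_congr rfl fun τ _ => key τ, Finset.sum_const, Finset.card_univ,
      ← Nat.cast_smul_eq_nsmul ℚ, inv_smul_smul₀]
    exact_mod_cast Fintype.card_ne_zero
  have h2 : L ∘ₗ homAverage ρ θ = ((Fintype.card G : ℚ)⁻¹) •
      ∑ τ : G, Representation.linHom (ρ.comp (MonoidHom.fst G H)) θ (τ, h) := by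
    refine LinearMap.ext fun f => ?_
    change θ (1, h) ∘ₗ (((Fintype.card G : ℚ)⁻¹) • ∑ τ : G, θ (τ, 1) ∘ₗ f ∘ₗ ρ τ⁻¹) = _
    rw [LinearMap.comp_smul, LinearMap.smul_apply, LinearMap.sum_apply]
    congr 1
    refine LinearMap.ext fun x => ?_
    simp only [LinearMap.comp_apply, LinearMap.sum_apply, map_sum]
    refine Finset.sum_congr rfl fun τ _ => ?_
    rw [← Module.End.mul_apply (θ _), ← map_mul, Prod.mk_mul_mk, mul_one, one_mul]
    rfl
  rw [h1, trace_comp_comm_rat, h2, map_smul, map_sum, smul_eq_mul]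
  congr 1
  refine Finset.sum_congr rfl fun τ _ => ?_
  exact Representation.char_linHom (ρ.comp (MonoidHom.fst G H)) θ (τ, h)

end Intertwining

section

variable (V : S2Module.{u}) (W : SModule.{u}) (n : ℕ) (ν : GenPart)

theorem trace_homRep (g : Equiv.Perm (Fin n)) :
    LinearMap.trace ℚ _ (homRep V W n ν g) = ((Fintype.card (SGrp ν) : ℚ)⁻¹) *
      ∑ τ : SGrp ν, LinearMap.trace ℚ _ (V.ρ ν τ⁻¹) *
        LinearMap.trace ℚ _ (tensorAct W ((τ, g) : SGrp ν × Equiv.Perm (Fin n))) := by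
  let _ : AddCommGroup (TensorPow W ν n) := Module.addCommMonoidToAddCommGroup ℚ
  have := homComp_finite V W n ν
  exact trace_intertwiningMap (U := TensorPow W ν n) (V.ρ ν) (tensorRep W ν n) g
    (homRep V W n ν g) fun f => rfl

theorem trace_TRep (g : Equiv.Perm (Fin n)) :
    LinearMap.trace ℚ _ (TRep V W n g) =
      ∑ ν ∈ V.bounded.toFinset, LinearMap.trace ℚ _ (homRep V W n ν g) := by
  let _ := fun ν => (Module.addCommMonoidToAddCommGroup ℚ : AddCommGroup (HomComp V W n ν))
  have := fun ν => homComp_finite V W n ν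
  have := TSpace_finite V W n
  refine (trace_directSum (M := HomComp V W n) V.bounded.toFinset (fun ν hν => ?_)
    (TRep V W n g)).trans ?_
  · refine homComp_subsingleton V W n ν ?_
    rw [Set.Finite.mem_toFinset] at hν
    exact not_nontrivial_iff_subsingleton.1 hν
  · refine Finset.sum_congr rfl fun ν _ => congrArg _ (LinearMap.ext fun x => ?_)
    change DirectSum.component ℚ _ _ ν ((DirectSum.lmap fun ν => homRep V W n ν g)
      (DirectSum.lof ℚ _ _ ν x)) = _
    rw [DirectSum.lmap_lof, DirectSum.component.lof_self]

theorem chSGrp_of_subsingleton {ν : GenPart} {X : Type u} [AddCommGroup X] [Module ℚ X]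
    [Subsingleton X] (ρ : Representation ℚ (SGrp ν) X) : chSGrp ρ = 0 := by
  rw [chSGrp, Finset.sum_eq_zero, smul_zero]
  intro σ _
  rw [Subsingleton.elim (ρ σ) 0, map_zero, zero_smul]

theorem S2Module.ch_eq_sum : V.ch = ∑ ν ∈ V.bounded.toFinset, chSGrp (V.ρ ν) := by
  refine finsum_eq_sum_of_support_subset _ fun ν hν => ?_
  rw [Set.Finite.coe_toFinset]
  by_contra h
  have : Subsingleton (V.V ν) := not_nontrivial_iff_subsingleton.1 h
  exact hν (chSGrp_of_subsingleton _)

end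

end WreathSymm

end

theorem mainTheorem6 (V : WreathSymm.S2Module.{u}) (W : WreathSymm.SModule.{u}) :
    WreathSymm.SModule.ch ((WreathSymm.T V).obj W) =
      WreathSymm.tcirc (WreathSymm.S2Module.ch V) (WreathSymm.SModule.ch W) := by
  open WreathSymm in
  refine ev_ext fun μ => ?_
  obtain ⟨n, g, rfl⟩ := exists_permType_eq μ
  rw [SModule.ev_ch]
  change LinearMap.trace ℚ _ (TRep V W n g) = _
  rw [trace_TRep, S2Module.ch_eq_sum, tcirc, map_sum, map_sum]
  refine Finset.sum_congr rfl fun ν _ => ?_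
  -- The Hom space carries the dual character `Tr(τ⁻¹ | V_ν)`; the substitution `τ ↦ τ⁻¹` moves the
  -- inverse to `twoType`, which is insensitive to it.
  rw [trace_homRep, chSGrp, map_smul, map_smul, smul_eq_mul, map_sum, map_sum,
    ← Equiv.sum_comp (Equiv.inv (SGrp ν))]
  congr 1
  refine Finset.sum_congr rfl fun τ _ => ?_
  rw [map_smul, map_smul, smul_eq_mul, trace_tensorAct_eq_ev, Equiv.inv_apply, inv_inv,
    twoType_inv]
  rfl
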